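/- **Proposition.** Let $N\in\mathbb{N}$ and let $\mathrm{d}U$ be the normalized Haar measure on $\mathrm{SU}(N)$. Representations are finite-dimensional, continuous and complex, $\chi_R(U)=\mathrm{Tr}\,R(U)$, $\overline R$ is the complex conjugate representation, and $\mathfrak{R}(\mathrm{SU}(N))$ is the Grothendieck ring: the Grothendieck completion of the semiring of isomorphism classes of representations under $\oplus$ and $\otimes$, with $[R]$ the class of $R$. For a representation $R$ let $\Omega_R=\sum_i \mathrm{d}R(X_i)\,\mathrm{d}R(X^i)$ be its quadratic Casimir operator, where $(X_i)$ is a basis of $\mathfrak{su}(N)$ and $(X^i)$ its dual basis for the form $\mathrm{Tr}(XY)$, and let $C_2(R)=\mathrm{Re}\,\mathrm{Tr}\,\Omega_R/\dim R$. Consider two-dimensional $\mathrm{SU}(N)$ Yang–Mills theory with coupling $g\in\mathbb{R}$ on a surface $\Sigma$ of genus $p\ge 0$ and area $a$ with one boundary circle (the disk of area $\tfrac12$ is the case $p=0$, $a=\tfrac12$). Let the Wilson loop $W_R$ run along $-\partial\Sigma$, and let $V[U]$ be the topological point operator that prescribes the holonomy around an interior point to lie in the conjugacy class of $U\in\mathrm{SU}(N)$.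 Their correlator is $$\langle U,R\rangle=\langle V[U]\,W_R\rangle=\int \mathrm{d}h\prod_{i=1}^p\mathrm{d}A_i\,\mathrm{d}B_i\ \mathrm{Tr}\Big(R\big(h^{-1}Uh\,\textstyle\prod_{i}A_iB_iA_i^{-1}B_i^{-1}\big)\,\mathrm{e}^{-\frac{g^2a}{2}\Omega_R}\Big),$$ with all integrals over $\mathrm{SU}(N)$. If the loop runs along $+\partial\Sigma$ instead, the argument of $R$ is replaced by its inverse. The correlator depends only on the conjugacy class of $U$ and on the isomorphism class of $R$, and extends additively to $\langle U,x\rangle$ for $x\in\mathfrak{R}(\mathrm{SU}(N))$. For either direction of the loop put $$\langle x|y\rangle=\int\mathrm{d}U\,\langle U,x\rangle\,\langle U,y\rangle,\qquad \mathcal{G}_\kappa(x)=\int\mathrm{d}U\,\chi_\kappa(U)\,\langle U,x\rangle ,$$ where $\mathcal G_\kappa$ is the gauging of the non-invertible 1-form symmetry with generalized $\theta$-angle $\kappa$, an irreducible representation. Write $w(R)=(\dim R)^{-2p}\,\mathrm{e}^{-\frac{g^2a}{2}C_2(R)}$. Let $\kappa^*=\overline\kappa$ if the loop runs along $-\partial\Sigma$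 and $\kappa^*=\kappa$ if it runs along $+\partial\Sigma$. Then: 1. For irreducible $R$, $\Omega_R=C_2(R)\,\mathbb{1}$, and $\langle U,R\rangle=\chi_R(U)\,w(R)$ for a loop along $-\partial\Sigma$, $\langle U,R\rangle=\chi_R(U^{-1})\,w(R)$ for a loop along $+\partial\Sigma$. 2. For either direction, the integrand of $\mathcal G_\kappa(x)$ is integrable for every $x$; for irreducible $R_1,R_2,R$ one has $\langle R_1|R_2\rangle=w(R_2)^2\,\delta_{\overline{R_1},R_2}$ and $\mathcal G_\kappa([R])=w(R)\,\delta_{\kappa^*,R}$, where $\delta_{R,S}$ is $1$ if $R\cong S$ and $0$ otherwise. 3. For all $x\in\mathfrak{R}(\mathrm{SU}(N))$, $\mathcal G_\kappa(x)=w(\kappa)^{-1}\langle\kappa|x\rangle$ for a loop along $-\partial\Sigma$, and $\mathcal G_\kappa(x)=w(\kappa)^{-1}\langle\overline\kappa|x\rangle$ for a loop along $+\partial\Sigma$. 4. For either direction there is exactly one additive map $P:\mathfrak{R}(\mathrm{SU}(N))\to\mathfrak{R}(\mathrm{SU}(N))$ such that $P[R]=[R]$ for irreducible $R\cong\kappa^*$,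 $P[R]=0$ for every other irreducible $R$, $P\circ P=P$, and for every $x$ there is $n\in\mathbb{Z}$ with $P(x)=n\,[\kappa^*]$ and $\mathcal G_\kappa(x)=n\,w(\kappa)$. -/

import Mathlib

open Matrix MeasureTheory

noncomputable section

set_option linter.unusedSectionVars false

namespace YM

/-! ## Finite-dimensional continuous representations and the Grothendieck ring -/

/-- A finite-dimensional continuous complex representation of a topological group `G`,
written in a basis. -/
structure MatRep (G : Type) [Group G] [TopologicalSpace G] where
  /-- the dimension -/
  dim : ℕ
  /-- the representing matrices -/
  mat : G →* Matrix (Fin dim) (Fin dim) ℂ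
  continuous_mat : Continuous mat

/-- Similarity of two families of matrices; a technical form of isomorphism that allows
arbitrary index types. -/
def Sim {G ι κ : Type} [Fintype ι] [DecidableEq ι] [Fintype κ] [DecidableEq κ]
    (ρ : G → Matrix ι ι ℂ) (σ : G → Matrix κ κ ℂ) : Prop :=
  ∃ (P : Matrix κ ι ℂ) (Q : Matrix ι κ ℂ), P * Q = 1 ∧ Q * P = 1 ∧ ∀ g, P * ρ g = σ g * P

namespace Sim

variable {G ι κ μ ι' κ' : Type} [Fintype ι] [DecidableEq ι] [Fintype κ] [DecidableEq κ]
  [Fintype μ] [DecidableEq μ] [Fintype ι'] [DecidableEq ι'] [Fintype κ'] [DecidableEq κ']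
  {ρ : G → Matrix ι ι ℂ} {σ : G → Matrix κ κ ℂ} {τ : G → Matrix μ μ ℂ}
  {ρ' : G → Matrix ι' ι' ℂ} {σ' : G → Matrix κ' κ' ℂ}

lemma eq_conj {P : Matrix κ ι ℂ} {Q : Matrix ι κ ℂ} (h1 : P * Q = 1)
    {A : Matrix ι ι ℂ} {B : Matrix κ κ ℂ} (h : P * A = B * P) : B = P * A * Q := by
  rw [h, Matrix.mul_assoc, h1, Matrix.mul_one]

lemma symm (h : Sim ρ σ) : Sim σ ρ := by
  obtain ⟨P, Q, h1, h2, h3⟩ := h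
  refine ⟨Q, P, h2, h1, fun g => ?_⟩
  rw [eq_conj h1 (h3 g), ← Matrix.mul_assoc, ← Matrix.mul_assoc, h2, Matrix.one_mul]

lemma trans (h : Sim ρ σ) (h' : Sim σ τ) : Sim ρ τ := by
  obtain ⟨P, Q, h1, h2, h3⟩ := h
  obtain ⟨P', Q', h1', h2', h3'⟩ := h'
  refine ⟨P' * P, Q * Q', ?_, ?_, fun g => ?_⟩
  · rw [Matrix.mul_assoc, ← Matrix.mul_assoc P, h1, Matrix.one_mul, h1']
  · rw [Matrix.mul_assoc, ← Matrix.mul_assoc Q', h2', Matrix.one_mul, h2]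
  · rw [Matrix.mul_assoc, h3, ← Matrix.mul_assoc, h3', Matrix.mul_assoc]

lemma of_reindex (e : ι ≃ κ) (h : ∀ g i j, σ g (e i) (e j) = ρ g i j) : Sim ρ σ := by
  refine ⟨(1 : Matrix κ κ ℂ).submatrix id e, (1 : Matrix κ κ ℂ).submatrix e id, ?_, ?_,
    fun g => ?_⟩
  · ext i j
    simp [Matrix.mul_apply, Matrix.one_apply, ← e.eq_symm_apply]
  · ext i j
    simp [Matrix.mul_apply, Matrix.one_apply]
  · ext i j
    obtain ⟨i, rfl⟩ := e.surjective i
    simp [Matrix.mul_apply, Matrix.one_apply, h]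

lemma sum (h : Sim ρ σ) (h' : Sim ρ' σ') :
    Sim (fun g => fromBlocks (ρ g) 0 0 (ρ' g)) (fun g => fromBlocks (σ g) 0 0 (σ' g)) := by
  obtain ⟨P, Q, h1, h2, h3⟩ := h
  obtain ⟨P', Q', h1', h2', h3'⟩ := h'
  refine ⟨fromBlocks P 0 0 P', fromBlocks Q 0 0 Q', ?_, ?_, fun g => ?_⟩ <;>
    simp [fromBlocks_multiply, *]

lemma kron (h : Sim ρ σ) (h' : Sim ρ' σ') :
    Sim (fun g => kroneckerMap (· * ·) (ρ g) (ρ' g))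
      (fun g => kroneckerMap (· * ·) (σ g) (σ' g)) := by
  obtain ⟨P, Q, h1, h2, h3⟩ := h
  obtain ⟨P', Q', h1', h2', h3'⟩ := h'
  refine ⟨kroneckerMap (· * ·) P P', kroneckerMap (· * ·) Q Q', ?_, ?_, fun g => ?_⟩ <;>
    simp [← mul_kronecker_mul, *]

end Sim

namespace MatRep

variable {G : Type} [Group G] [TopologicalSpace G]

/-- The underlying representation on `ℂⁿ` in the sense of Mathlib. -/
def toRep (R : MatRep G) : Representation ℂ G (Fin R.dim → ℂ) :=
  (Matrix.toLinAlgEquiv' : Matrix (Fin R.dim) (Fin R.dim) ℂ ≃ₐ[ℂ] _).toMonoidHom.comp R.mat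

/-- Isomorphism of representations. -/
def Iso (R S : MatRep G) : Prop := Nonempty (R.toRep.Equiv S.toRep)

/-- Irreducibility: nonzero, and no proper nonzero invariant subspace. -/
def IsIrreducible (R : MatRep G) : Prop := R.toRep.IsIrreducible

/-- The character `g ↦ Tr R(g)`. -/
def char (R : MatRep G) (g : G) : ℂ := (R.mat g).trace

lemma iso_iff_sim {R S : MatRep G} : R.Iso S ↔ Sim R.mat S.mat := by
  constructor
  · rintro ⟨e⟩
    refine ⟨LinearMap.toMatrix' e.toLinearEquiv.toLinearMap,
      LinearMap.toMatrix' e.toLinearEquiv.symm.toLinearMap, ?_, ?_, fun g => ?_⟩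
    · rw [← LinearMap.toMatrix'_comp, LinearEquiv.comp_symm, LinearMap.toMatrix'_id]
    · rw [← LinearMap.toMatrix'_comp, LinearEquiv.symm_comp, LinearMap.toMatrix'_id]
    · have := congrArg LinearMap.toMatrix' (e.toIntertwiningMap.isIntertwining' g)
      rw [LinearMap.toMatrix'_comp, LinearMap.toMatrix'_comp] at this
      have hR : LinearMap.toMatrix' (R.toRep g) = R.mat g := LinearMap.toMatrix'_toLin' _
      have hS : LinearMap.toMatrix' (S.toRep g) = S.mat g := LinearMap.toMatrix'_toLin' _
      rw [hR, hS] at this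
      exact this
  · rintro ⟨P, Q, h1, h2, h3⟩
    refine ⟨Representation.Equiv.mk
      (LinearEquiv.ofLinearMap (Matrix.toLin' P) (Matrix.toLin' Q) ?_ ?_) fun g => ?_⟩
    · rw [← Matrix.toLin'_mul, h1, Matrix.toLin'_one]
    · rw [← Matrix.toLin'_mul, h2, Matrix.toLin'_one]
    · change Matrix.toLin' P ∘ₗ Matrix.toLin' (R.mat g) =
        Matrix.toLin' (S.mat g) ∘ₗ Matrix.toLin' P
      rw [← Matrix.toLin'_mul, ← Matrix.toLin'_mul, h3]

instance setoid (G : Type) [Group G] [TopologicalSpace G] : Setoid (MatRep G) where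
  r := Iso
  iseqv :=
    { refl := fun _ => ⟨Representation.Equiv.refl _⟩
      symm := fun ⟨e⟩ => ⟨e.symm⟩
      trans := fun ⟨e⟩ ⟨f⟩ => ⟨e.trans f⟩ }

/-- The zero-dimensional representation. -/
def zero (G : Type) [Group G] [TopologicalSpace G] : MatRep G where
  dim := 0
  mat := 1
  continuous_mat := continuous_const

/-- The one-dimensional trivial representation. -/
def triv (G : Type) [Group G] [TopologicalSpace G] : MatRep G where
  dim := 1
  mat := 1
  continuous_mat := continuous_const

/-- The direct sum, by block diagonal matrices. -/
def sum (R S : MatRep G) : MatRep G where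
  dim := R.dim + S.dim
  mat :=
    { toFun := fun g => reindex finSumFinEquiv finSumFinEquiv
        (fromBlocks (R.mat g) 0 0 (S.mat g))
      map_one' := by simp
      map_mul' := fun g h => by
        simp [fromBlocks_multiply, submatrix_mul_equiv] }
  continuous_mat := by
    have := R.continuous_mat
    have := S.continuous_mat
    exact Continuous.matrix_submatrix (by fun_prop) _ _

/-- The tensor product, by Kronecker products. -/
def tensor (R S : MatRep G) : MatRep G where
  dim := R.dim * S.dim
  mat :=
    { toFun := fun g => reindex finProdFinEquiv finProdFinEquiv
        (kroneckerMap (· * ·) (R.mat g) (S.mat g))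
      map_one' := by simp
      map_mul' := fun g h => by
        simp [mul_kronecker_mul, submatrix_mul_equiv] }
  continuous_mat := by
    have hR := R.continuous_mat
    have hS := S.continuous_mat
    refine Continuous.matrix_submatrix ?_ _ _
    refine continuous_matrix fun i j => ?_
    exact (hR.matrix_elem _ _).mul (hS.matrix_elem _ _)

/-- The complex conjugate representation. -/
def conj (R : MatRep G) : MatRep G where
  dim := R.dim
  mat := ((starRingEnd ℂ).mapMatrix : _ →+* Matrix (Fin R.dim) (Fin R.dim) ℂ).toMonoidHom.comp
    R.mat
  continuous_mat := by
    have hR := R.continuous_mat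
    exact continuous_matrix fun i j => Complex.continuous_conj.comp (hR.matrix_elem _ _)

lemma sim_sum (R S : MatRep G) :
    Sim (fun g => fromBlocks (R.mat g) 0 0 (S.mat g)) (R.sum S).mat :=
  Sim.of_reindex finSumFinEquiv fun g i j => by
    change fromBlocks (R.mat g) 0 0 (S.mat g) (finSumFinEquiv.symm (finSumFinEquiv i))
      (finSumFinEquiv.symm (finSumFinEquiv j)) = _
    simp only [Equiv.symm_apply_apply]

lemma sim_tensor (R S : MatRep G) :
    Sim (fun g => kroneckerMap (· * ·) (R.mat g) (S.mat g)) (R.tensor S).mat :=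
  Sim.of_reindex finProdFinEquiv fun g i j => by
    change kroneckerMap (· * ·) (R.mat g) (S.mat g) (finProdFinEquiv.symm (finProdFinEquiv i))
      (finProdFinEquiv.symm (finProdFinEquiv j)) = _
    simp only [Equiv.symm_apply_apply]

lemma sim_refl (R : MatRep G) : Sim R.mat R.mat := ⟨1, 1, by simp, by simp, by simp⟩

lemma sum_congr {R R' S S' : MatRep G} (h : R.Iso R') (h' : S.Iso S') :
    (R.sum S).Iso (R'.sum S') := by
  rw [iso_iff_sim] at *
  exact ((sim_sum R S).symm.trans (h.sum h')).trans (sim_sum R' S')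

lemma tensor_congr {R R' S S' : MatRep G} (h : R.Iso R') (h' : S.Iso S') :
    (R.tensor S).Iso (R'.tensor S') := by
  rw [iso_iff_sim] at *
  exact ((sim_tensor R S).symm.trans (h.kron h')).trans (sim_tensor R' S')

lemma sum_comm_iso (R S : MatRep G) : (R.sum S).Iso (S.sum R) := by
  rw [iso_iff_sim]
  refine ((sim_sum R S).symm.trans (Sim.of_reindex (Equiv.sumComm _ _) ?_)).trans (sim_sum S R)
  rintro g (i | i) (j | j) <;> simp

lemma sum_assoc_iso (R S T : MatRep G) : ((R.sum S).sum T).Iso (R.sum (S.sum T)) := by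
  rw [iso_iff_sim]
  refine ((sim_sum _ T).symm.trans ((sim_sum R S).symm.sum T.sim_refl)).trans
    (Sim.trans ?_ ((R.sim_refl.sum (sim_sum S T)).trans (sim_sum R _)))
  refine Sim.of_reindex (Equiv.sumAssoc _ _ _) ?_
  rintro g ((i | i) | i) ((j | j) | j) <;> simp

lemma zero_sum_iso (R : MatRep G) : ((zero G).sum R).Iso R := by
  rw [iso_iff_sim]
  refine (sim_sum _ R).symm.trans ?_
  have : IsEmpty (Fin (zero G).dim) := Fin.isEmpty
  refine Sim.of_reindex (Equiv.emptySum _ _) ?_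
  rintro g (i | i) (j | j)
  · exact isEmptyElim i
  · exact isEmptyElim i
  · exact isEmptyElim j
  · simp

lemma tensor_comm_iso (R S : MatRep G) : (R.tensor S).Iso (S.tensor R) := by
  rw [iso_iff_sim]
  refine ((sim_tensor R S).symm.trans (Sim.of_reindex (Equiv.prodComm _ _) ?_)).trans
    (sim_tensor S R)
  rintro g ⟨i, i'⟩ ⟨j, j'⟩
  simp [mul_comm]

lemma tensor_assoc_iso (R S T : MatRep G) :
    ((R.tensor S).tensor T).Iso (R.tensor (S.tensor T)) := by
  rw [iso_iff_sim]
  refine ((sim_tensor _ T).symm.trans ((sim_tensor R S).symm.kron T.sim_refl)).trans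
    (Sim.trans ?_ ((R.sim_refl.kron (sim_tensor S T)).trans (sim_tensor R _)))
  refine Sim.of_reindex (Equiv.prodAssoc _ _ _) ?_
  rintro g ⟨⟨i, i'⟩, i''⟩ ⟨⟨j, j'⟩, j''⟩
  simp [mul_assoc]

lemma triv_tensor_iso (R : MatRep G) : ((triv G).tensor R).Iso R := by
  rw [iso_iff_sim]
  refine (sim_tensor _ R).symm.trans ?_
  let _ : Unique (Fin (triv G).dim) := inferInstanceAs (Unique (Fin 1))
  refine Sim.of_reindex (Equiv.uniqueProd _ _) ?_
  rintro g ⟨i, i'⟩ ⟨j, j'⟩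
  obtain rfl : i = j := Subsingleton.elim (α := Fin 1) i j
  have h : (triv G).mat g i i = 1 := Matrix.one_apply_eq (α := ℂ) (n := Fin 1) i
  simp only [kroneckerMap_apply, h, one_mul]
  rfl

lemma zero_tensor_iso (R : MatRep G) : ((zero G).tensor R).Iso (zero G) := by
  rw [iso_iff_sim]
  refine (sim_tensor _ R).symm.trans ?_
  have : IsEmpty (Fin (zero G).dim) := Fin.isEmpty
  exact Sim.of_reindex (Equiv.equivOfIsEmpty _ _) fun g i => isEmptyElim i

lemma sum_tensor_iso (R S T : MatRep G) :
    ((R.sum S).tensor T).Iso ((R.tensor T).sum (S.tensor T)) := by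
  rw [iso_iff_sim]
  refine ((sim_tensor _ T).symm.trans ((sim_sum R S).symm.kron T.sim_refl)).trans
    (Sim.trans ?_ (((sim_tensor R T).sum (sim_tensor S T)).trans (sim_sum _ _)))
  refine Sim.of_reindex (Equiv.sumProdDistrib _ _ _) ?_
  rintro g ⟨i | i, i'⟩ ⟨j | j, j'⟩ <;> simp

end MatRep

/-- Isomorphism classes of finite-dimensional continuous representations. -/
def RepClass (G : Type) [Group G] [TopologicalSpace G] : Type := Quotient (MatRep.setoid G)

namespace RepClass

variable {G : Type} [Group G] [TopologicalSpace G]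

/-- The isomorphism class of a representation. -/
def mk (R : MatRep G) : RepClass G := Quotient.mk _ R

instance : Zero (RepClass G) := ⟨mk (MatRep.zero G)⟩

instance : One (RepClass G) := ⟨mk (MatRep.triv G)⟩

instance : Add (RepClass G) :=
  ⟨Quotient.map₂ MatRep.sum fun _ _ h _ _ h' => MatRep.sum_congr h h'⟩

instance : Mul (RepClass G) :=
  ⟨Quotient.map₂ MatRep.tensor fun _ _ h _ _ h' => MatRep.tensor_congr h h'⟩

/-- Isomorphism classes form a commutative semiring under direct sum and tensor product. -/
instance : CommSemiring (RepClass G) where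
  nsmul := nsmulRec
  npow := npowRec
  add_assoc := by rintro ⟨a⟩ ⟨b⟩ ⟨c⟩; exact Quotient.sound (MatRep.sum_assoc_iso a b c)
  add_comm := by rintro ⟨a⟩ ⟨b⟩; exact Quotient.sound (MatRep.sum_comm_iso a b)
  zero_add := by rintro ⟨a⟩; exact Quotient.sound (MatRep.zero_sum_iso a)
  add_zero := by
    rintro ⟨a⟩
    exact Quotient.sound (Setoid.trans (MatRep.sum_comm_iso a _) (MatRep.zero_sum_iso a))
  mul_assoc := by rintro ⟨a⟩ ⟨b⟩ ⟨c⟩; exact Quotient.sound (MatRep.tensor_assoc_iso a b c)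
  mul_comm := by rintro ⟨a⟩ ⟨b⟩; exact Quotient.sound (MatRep.tensor_comm_iso a b)
  one_mul := by rintro ⟨a⟩; exact Quotient.sound (MatRep.triv_tensor_iso a)
  mul_one := by
    rintro ⟨a⟩
    exact Quotient.sound (Setoid.trans (MatRep.tensor_comm_iso a _) (MatRep.triv_tensor_iso a))
  zero_mul := by rintro ⟨a⟩; exact Quotient.sound (MatRep.zero_tensor_iso a)
  mul_zero := by
    rintro ⟨a⟩
    exact Quotient.sound (Setoid.trans (MatRep.tensor_comm_iso a _) (MatRep.zero_tensor_iso a))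
  right_distrib := by
    rintro ⟨a⟩ ⟨b⟩ ⟨c⟩; exact Quotient.sound (MatRep.sum_tensor_iso a b c)
  left_distrib := by
    rintro ⟨a⟩ ⟨b⟩ ⟨c⟩
    exact Quotient.sound (Setoid.trans (MatRep.tensor_comm_iso a _)
      (Setoid.trans (MatRep.sum_tensor_iso b c a)
        (MatRep.sum_congr (MatRep.tensor_comm_iso b a) (MatRep.tensor_comm_iso c a))))

end RepClass

/-- The Grothendieck ring of the category of finite-dimensional continuous representations of
`G`: the Grothendieck completion of the semiring of isomorphism classes. -/
def RepRing (G : Type) [Group G] [TopologicalSpace G] : Type :=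
  Algebra.GrothendieckAddGroup (RepClass G)

namespace RepRing

variable {G : Type} [Group G] [TopologicalSpace G]

instance : AddCommGroup (RepRing G) :=
  inferInstanceAs (AddCommGroup (Algebra.GrothendieckAddGroup (RepClass G)))

/-- The canonical map from isomorphism classes to the Grothendieck ring. -/
def of : RepClass G →+ RepRing G := Algebra.GrothendieckAddGroup.of

/-- The universal property of the Grothendieck completion. -/
def lift {A : Type} [AddCommGroup A] (f : RepClass G →+ A) : RepRing G →+ A :=
  Algebra.GrothendieckAddGroup.lift f

@[simp]
lemma lift_of {A : Type} [AddCommGroup A] (f : RepClass G →+ A) (x : RepClass G) :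
    lift f (of x) = f x :=
  DFunLike.congr_fun (Algebra.GrothendieckAddGroup.lift.symm_apply_apply f) x

lemma exists_sub (x : RepRing G) : ∃ a b : RepClass G, x = of a - of b := by
  have h := Algebra.GrothendieckAddGroup.lift_apply
    (Algebra.GrothendieckAddGroup.of (M := RepClass G)) x
  have h2 : Algebra.GrothendieckAddGroup.lift
      (Algebra.GrothendieckAddGroup.of (M := RepClass G)) = AddMonoidHom.id _ := by
    apply Algebra.GrothendieckAddGroup.lift.symm.injective
    simp
  rw [h2] at h
  exact ⟨_, _, h⟩

/-- The multiplication induced by the tensor product, as a biadditive map. -/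
def mulHom : RepRing G →+ RepRing G →+ RepRing G :=
  lift
    { toFun := fun a => lift (of.comp (AddMonoidHom.mulLeft a))
      map_zero' := by
        ext x
        obtain ⟨b, c, rfl⟩ := exists_sub x
        simp
      map_add' := fun a a' => by
        ext x
        obtain ⟨b, c, rfl⟩ := exists_sub x
        simp [add_mul]
        abel }

lemma mulHom_of (a b : RepClass G) : mulHom (of a) (of b) = of (a * b) := by
  simp [mulHom]

instance : Mul (RepRing G) := ⟨fun x y => mulHom x y⟩

instance : One (RepRing G) := ⟨of 1⟩

instance : CommRing (RepRing G) where
  __ := (inferInstance : AddCommGroup (RepRing G))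
  npow := npowRec
  natCast := Nat.unaryCast
  left_distrib x y z := map_add (mulHom x) y z
  right_distrib x y z := by
    change mulHom (x + y) z = mulHom x z + mulHom y z
    simp
  zero_mul x := by
    change mulHom 0 x = 0
    simp
  mul_zero x := map_zero (mulHom x)
  mul_assoc x y z := by
    change mulHom (mulHom x y) z = mulHom x (mulHom y z)
    obtain ⟨a, b, rfl⟩ := exists_sub x
    obtain ⟨c, d, rfl⟩ := exists_sub y
    obtain ⟨e, f, rfl⟩ := exists_sub z
    simp only [map_sub, AddMonoidHom.sub_apply, mulHom_of, mul_assoc]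
  one_mul x := by
    change mulHom (of 1) x = x
    obtain ⟨a, b, rfl⟩ := exists_sub x
    simp only [map_sub, mulHom_of, one_mul]
  mul_one x := by
    change mulHom x (of 1) = x
    obtain ⟨a, b, rfl⟩ := exists_sub x
    simp only [map_sub, AddMonoidHom.sub_apply, mulHom_of, mul_one]
  mul_comm x y := by
    change mulHom x y = mulHom y x
    obtain ⟨a, b, rfl⟩ := exists_sub x
    obtain ⟨c, d, rfl⟩ := exists_sub y
    simp only [map_sub, AddMonoidHom.sub_apply, mulHom_of, mul_comm]
    abel

/-- The class `[R]` of a representation in the Grothendieck ring. -/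
def cls (R : MatRep G) : RepRing G := of (RepClass.mk R)

end RepRing

/-! ## The group `SU(N)`, its Lie algebra and its Haar measure -/

/-- The special unitary group. -/
abbrev SU (N : ℕ) : Type := Matrix.specialUnitaryGroup (Fin N) ℂ

namespace SU

variable {N : ℕ}

instance : IsTopologicalGroup (SU N) where
  continuous_inv := by
    refine Continuous.subtype_mk (f := fun U : SU N => star (U : Matrix (Fin N) (Fin N) ℂ)) ?_ _
    exact continuous_star.comp continuous_subtype_val

instance : SecondCountableTopology (SU N) :=
  haveI : SecondCountableTopology (Matrix (Fin N) (Fin N) ℂ) :=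
    inferInstanceAs (SecondCountableTopology (Fin N → Fin N → ℂ))
  TopologicalSpace.Subtype.secondCountableTopology _

instance : CompactSpace (SU N) := by
  suffices h : IsCompact (Matrix.specialUnitaryGroup (Fin N) ℂ : Set (Matrix (Fin N) (Fin N) ℂ)) from
    isCompact_iff_compactSpace.mp h
  have hK : IsCompact (Set.pi Set.univ fun _ : Fin N => Set.pi Set.univ fun _ : Fin N =>
      Metric.closedBall (0 : ℂ) 1) :=
    isCompact_univ_pi fun _ => isCompact_univ_pi fun _ => isCompact_closedBall _ _
  refine IsCompact.of_isClosed_subset hK ?_ ?_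
  · have : (Matrix.specialUnitaryGroup (Fin N) ℂ : Set (Matrix (Fin N) (Fin N) ℂ)) =
        {A | A * star A = 1} ∩ {A | A.det = 1} := by
      ext A
      simp [Matrix.mem_specialUnitaryGroup_iff, Matrix.mem_unitaryGroup_iff]
    rw [this]
    exact (isClosed_eq (by fun_prop) continuous_const).inter
      (isClosed_eq (by fun_prop) continuous_const)
  · intro A hA i _ j _
    rw [mem_closedBall_zero_iff]
    exact entry_norm_bound_of_unitary (Matrix.mem_specialUnitaryGroup_iff.mp hA).1 i j

instance : MeasurableSpace (SU N) := borel _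

instance : BorelSpace (SU N) := ⟨rfl⟩

/-- The normalized Haar measure on `SU(N)`. -/
def haar (N : ℕ) : Measure (SU N) := Measure.haarMeasure ⊤

instance : IsProbabilityMeasure (haar N) :=
  ⟨by simpa [haar] using Measure.haarMeasure_self (K₀ := (⊤ : TopologicalSpace.PositiveCompacts (SU N)))⟩

instance : (haar N).IsHaarMeasure := Measure.isHaarMeasure_haarMeasure _

end SU

/-- The Lie algebra `𝔰𝔲(N)` of traceless anti-Hermitian matrices, as a real vector space. -/
def su (N : ℕ) : Submodule ℝ (Matrix (Fin N) (Fin N) ℂ) where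
  carrier := {X | Xᴴ = -X ∧ X.trace = 0}
  zero_mem' := by simp
  add_mem' := by
    rintro X Y ⟨h1, h2⟩ ⟨h3, h4⟩
    exact ⟨by rw [conjTranspose_add, h1, h3]; abel, by rw [trace_add, h2, h4, add_zero]⟩
  smul_mem' := by
    rintro c X ⟨h1, h2⟩
    exact ⟨by rw [conjTranspose_smul, h1]; simp, by rw [trace_smul, h2, smul_zero]⟩

namespace su

variable {N : ℕ}

lemma det_exp {X : Matrix (Fin N) (Fin N) ℂ} (hX : X ∈ su N) :
    (NormedSpace.exp X).det = 1 := by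
  have hH : (Complex.I • X).IsHermitian := by
    rw [Matrix.IsHermitian, conjTranspose_smul, hX.1]
    simp
  obtain ⟨U, D, hU, hXD⟩ : ∃ (U : Matrix (Fin N) (Fin N) ℂ) (D : Fin N → ℂ), IsUnit U ∧
      X = U * diagonal D * U⁻¹ := by
    refine ⟨hH.eigenvectorUnitary, fun i => -Complex.I * hH.eigenvalues i, ?_, ?_⟩
    · exact (Unitary.toUnits hH.eigenvectorUnitary).isUnit
    · have h := hH.spectral_theorem
      rw [Unitary.conjStarAlgAut_apply] at h
      have h2 : -Complex.I • (Complex.I • X) = X := by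
        rw [smul_smul]; simp
      refine h2.symm.trans ((congrArg (fun Y => -Complex.I • Y) h).trans ?_)
      have h3 : (hH.eigenvectorUnitary : Matrix (Fin N) (Fin N) ℂ)⁻¹ =
          star (hH.eigenvectorUnitary : Matrix (Fin N) (Fin N) ℂ) :=
        Matrix.inv_eq_right_inv (Unitary.coe_mul_star_self _)
      rw [h3, ← Matrix.smul_mul, ← Matrix.mul_smul]
      congr 2
      ext i j
      by_cases hij : i = j
      · subst hij; simp
      · simp [hij]
  have htr : ∑ i, D i = 0 := by
    have := hX.2
    rw [hXD, Matrix.trace_mul_comm, ← Matrix.mul_assoc,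
      Matrix.nonsing_inv_mul _ ((Matrix.isUnit_iff_isUnit_det _).mp hU), Matrix.one_mul,
      Matrix.trace_diagonal] at this
    exact this
  rw [hXD, Matrix.exp_conj _ _ hU, Matrix.det_conj hU, Matrix.exp_diagonal, Matrix.det_diagonal]
  have : ∀ i, (NormedSpace.exp D) i = Complex.exp (D i) := fun i => by
    rw [Pi.coe_exp, Complex.exp_eq_exp_ℂ]
  simp_rw [this]
  rw [← Complex.exp_sum, htr, Complex.exp_zero]

/-- The one-parameter subgroup `t ↦ exp (t X)` of `SU(N)`. -/
def exp (X : su N) (t : ℝ) : SU N :=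
  ⟨NormedSpace.exp (t • (X : Matrix (Fin N) (Fin N) ℂ)), by
    have hmem : t • (X : Matrix (Fin N) (Fin N) ℂ) ∈ su N := (su N).smul_mem t X.2
    rw [Matrix.mem_specialUnitaryGroup_iff, Matrix.mem_unitaryGroup_iff]
    refine ⟨?_, det_exp hmem⟩
    rw [star_eq_conjTranspose, ← Matrix.exp_conjTranspose, hmem.1, Matrix.exp_neg]
    exact Matrix.mul_nonsing_inv _ ((Matrix.isUnit_iff_isUnit_det _).mp (Matrix.isUnit_exp _))⟩

lemma exp_zero (X : su N) : exp X 0 = 1 := by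
  apply Subtype.ext
  simp [exp]

lemma exp_add (X : su N) (s t : ℝ) : exp X (s + t) = exp X s * exp X t := by
  apply Subtype.ext
  change NormedSpace.exp _ = NormedSpace.exp _ * NormedSpace.exp _
  rw [add_smul]
  exact Matrix.exp_add_of_commute _ _ ((Commute.refl _).smul_left s |>.smul_right t)

lemma continuous_exp (X : su N) : Continuous (exp X) := by
  refine Continuous.subtype_mk ?_ _
  let _ : NormedRing (Matrix (Fin N) (Fin N) ℂ) := Matrix.linftyOpNormedRing
  let _ : NormedAlgebra ℝ (Matrix (Fin N) (Fin N) ℂ) := Matrix.linftyOpNormedAlgebra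
  let _ : NormedAlgebra ℚ (Matrix (Fin N) (Fin N) ℂ) := NormedAlgebra.restrictScalars ℚ ℝ _
  exact (NormedSpace.exp_continuous (𝔸 := Matrix (Fin N) (Fin N) ℂ)).comp (by fun_prop)

/-- The invariant symmetric bilinear form `(X, Y) ↦ Tr (X Y)` on `𝔰𝔲(N)` (its values are real). -/
def form (N : ℕ) : LinearMap.BilinForm ℝ (su N) :=
  LinearMap.mk₂ ℝ (fun X Y => (((X : Matrix (Fin N) (Fin N) ℂ) *
      (Y : Matrix (Fin N) (Fin N) ℂ)).trace).re)
    (fun X X' Y => by simp [add_mul])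
    (fun c X Y => by simp)
    (fun X Y Y' => by simp [mul_add])
    (fun c X Y => by simp)

lemma form_isSymm : (form N).IsSymm :=
  ⟨fun X Y => by simp [form, Matrix.trace_mul_comm (X : Matrix (Fin N) (Fin N) ℂ)]⟩

open ComplexOrder in
lemma form_nondegenerate : (form N).Nondegenerate := by
  have key : ∀ X : su N, form N X X = 0 → X = 0 := by
    intro X h
    have h1 : (X : Matrix (Fin N) (Fin N) ℂ) * X = -((X : Matrix (Fin N) (Fin N) ℂ)ᴴ * X) := by
      rw [X.2.1]; simp
    have h2 : (((X : Matrix (Fin N) (Fin N) ℂ)ᴴ * X).trace).re = 0 := by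
      have : form N X X = (((X : Matrix (Fin N) (Fin N) ℂ) * X).trace).re := rfl
      rw [this, h1] at h
      simpa using h
    have h3 : ((X : Matrix (Fin N) (Fin N) ℂ)ᴴ * X).trace = 0 := by
      have hp := (Matrix.posSemidef_conjTranspose_mul_self
        (X : Matrix (Fin N) (Fin N) ℂ)).trace_nonneg
      exact Complex.ext h2 (Complex.le_def.mp hp).2.symm
    exact Subtype.ext (Matrix.trace_conjTranspose_mul_self_eq_zero_iff.mp h3)
  exact ⟨fun X h => key X (h X), fun X h => key X (h X)⟩

end su

section OneParameter

open intervalIntegral in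
/-- A continuous one-parameter group in a Banach algebra is differentiable. -/
lemma differentiable_of_oneParam {A : Type} [NormedRing A] [NormedAlgebra ℝ A] [CompleteSpace A]
    {φ : ℝ → A} (hc : Continuous φ) (h0 : φ 0 = 1) (hadd : ∀ s t, φ (s + t) = φ s * φ t) :
    Differentiable ℝ φ := by
  set M : ℝ → A := fun a => ∫ s in (0 : ℝ)..a, φ s with hM
  have hMd : ∀ x, HasDerivAt M (φ x) x := fun x =>
    integral_hasDerivAt_right (hc.intervalIntegrable _ _)
      (hc.stronglyMeasurableAtFilter _ _) hc.continuousAt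
  obtain ⟨a, ha0, hu⟩ : ∃ a : ℝ, a ≠ 0 ∧ IsUnit (a⁻¹ • M a) := by
    have h1 : Filter.Tendsto (fun a : ℝ => a⁻¹ • M a) (nhdsWithin 0 {0}ᶜ) (nhds 1) := by
      have := (hMd 0).tendsto_slope_zero
      simpa [hM, h0] using this
    have h2 : ∀ᶠ a in nhdsWithin (0 : ℝ) {0}ᶜ, IsUnit (a⁻¹ • M a) :=
      h1.eventually (Units.isOpen.mem_nhds isUnit_one)
    obtain ⟨a, h3, h4⟩ := (h2.and self_mem_nhdsWithin).exists
    exact ⟨a, h4, h3⟩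
  obtain ⟨B, hB⟩ : ∃ B, M a * B = 1 := by
    obtain ⟨u, hu⟩ := hu
    refine ⟨a⁻¹ • (↑u⁻¹ : A), ?_⟩
    rw [mul_smul_comm, ← smul_mul_assoc, ← hu]
    simp
  have key : ∀ t, φ t = (M (t + a) - M t) * B := by
    intro t
    have : φ t * M a = M (t + a) - M t := by
      have h := (ContinuousLinearMap.mul ℝ A (φ t)).intervalIntegral_comp_comm
        (hc.intervalIntegrable (μ := volume) 0 a)
      simp only [ContinuousLinearMap.mul_apply'] at h
      rw [hM]
      simp only
      rw [← h]
      simp_rw [← hadd]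
      rw [intervalIntegral.integral_comp_add_left (fun x => φ x) t, add_zero,
        intervalIntegral.integral_interval_sub_left (hc.intervalIntegrable _ _)
          (hc.intervalIntegrable _ _)]
    rw [← this, mul_assoc, hB, mul_one]
  intro t
  have h1 : HasDerivAt (fun t => (M (t + a) - M t) * B) ((φ (t + a) - φ t) * B) t :=
    (((hMd (t + a)).comp_add_const t a).sub (hMd t)).mul_const B
  have h2 : φ = fun t => (M (t + a) - M t) * B := funext key
  rw [h2]
  exact h1.differentiableAt

end OneParameter

/-! ## The quadratic Casimir operator -/

namespace MatRep

variable {N : ℕ}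

/-- The derived representation `dR(X) = d/dt R(exp (t X))` at `t = 0` of `𝔰𝔲(N)`. -/
def deriv (R : MatRep (SU N)) (X : su N) : Matrix (Fin R.dim) (Fin R.dim) ℂ :=
  Matrix.of fun i j => _root_.deriv (fun t : ℝ => R.mat (su.exp X t) i j) 0

/-- The quadratic Casimir operator `∑ᵢ dR(Xᵢ) dR(Xⁱ)`, with `Xᵢ` a basis of `𝔰𝔲(N)` and `Xⁱ` the
dual basis for the form `Tr (X Y)`; equivalently `-∑ₐ dR(Tₐ)²` for a basis `Tₐ` that is
orthonormal for `-Tr (X Y)`. In the fundamental representation it is `N - 1 / N`. -/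
def casimir (R : MatRep (SU N)) : Matrix (Fin R.dim) (Fin R.dim) ℂ :=
  ∑ i, R.deriv (Module.finBasis ℝ (su N) i) *
    R.deriv ((su.form N).dualBasis su.form_nondegenerate (Module.finBasis ℝ (su N)) i)

/-- The quadratic Casimir invariant `C₂(R)`: the normalized trace of the Casimir operator, hence
the scalar by which it acts if `R` is irreducible. -/
def C2 (R : MatRep (SU N)) : ℝ := R.casimir.trace.re / R.dim

/-- The propagator `exp (-(g² a / 2) Ω)` of Yang–Mills theory with coupling `g` over a region of
area `a`, where `Ω` is the Casimir operator: the mean of `R(b)` for the holonomy fluctuation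
`b` accumulated over this region. -/
def heat (g a : ℝ) (R : MatRep (SU N)) : Matrix (Fin R.dim) (Fin R.dim) ℂ :=
  NormedSpace.exp (-((g ^ 2 * a / 2 : ℝ) : ℂ) • R.casimir)

lemma differentiableAt_mat (R : MatRep (SU N)) (X : su N) (i j : Fin R.dim) (t : ℝ) :
    DifferentiableAt ℝ (fun t : ℝ => R.mat (su.exp X t) i j) t := by
  let _ : NormedRing (Matrix (Fin R.dim) (Fin R.dim) ℂ) := Matrix.linftyOpNormedRing
  let _ : NormedAlgebra ℝ (Matrix (Fin R.dim) (Fin R.dim) ℂ) := Matrix.linftyOpNormedAlgebra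
  have hcomp : CompleteSpace (Matrix (Fin R.dim) (Fin R.dim) ℂ) :=
    FiniteDimensional.complete ℝ _
  have h := differentiable_of_oneParam (A := Matrix (Fin R.dim) (Fin R.dim) ℂ)
    (φ := fun t => R.mat (su.exp X t)) (R.continuous_mat.comp (su.continuous_exp X))
    (by rw [su.exp_zero, map_one]) (fun s t => by rw [su.exp_add, map_mul]) t
  let L : Matrix (Fin R.dim) (Fin R.dim) ℂ →ₗ[ℝ] ℂ :=
    { toFun := fun M => M i j
      map_add' := fun _ _ => rfl
      map_smul' := fun _ _ => rfl }
  exact (LinearMap.toContinuousLinearMap L).differentiableAt.comp t h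

lemma deriv_conj {R S : MatRep (SU N)} {P : Matrix (Fin S.dim) (Fin R.dim) ℂ}
    {Q : Matrix (Fin R.dim) (Fin S.dim) ℂ} (h : ∀ g, S.mat g = P * R.mat g * Q) (X : su N) :
    S.deriv X = P * R.deriv X * Q := by
  ext i j
  have h1 : (fun t : ℝ => S.mat (su.exp X t) i j) =
      fun t => ∑ l, (∑ k, P i k * R.mat (su.exp X t) k l) * Q l j := by
    funext t
    rw [h]
    simp [Matrix.mul_apply]
  have hd : ∀ k l, HasDerivAt (fun t : ℝ => R.mat (su.exp X t) k l) (R.deriv X k l) 0 :=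
    fun k l => (R.differentiableAt_mat X k l 0).hasDerivAt
  have h2 : HasDerivAt (fun t : ℝ => ∑ l, (∑ k, P i k * R.mat (su.exp X t) k l) * Q l j)
      (∑ l, (∑ k, P i k * R.deriv X k l) * Q l j) 0 :=
    HasDerivAt.fun_sum fun l _ =>
      (HasDerivAt.fun_sum fun k _ => (hd k l).const_mul (P i k)).mul_const (Q l j)
  change _root_.deriv (fun t : ℝ => S.mat (su.exp X t) i j) 0 = _
  rw [h1, h2.deriv]
  simp [Matrix.mul_apply]

lemma casimir_conj {R S : MatRep (SU N)} {P : Matrix (Fin S.dim) (Fin R.dim) ℂ}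
    {Q : Matrix (Fin R.dim) (Fin S.dim) ℂ} (hQP : Q * P = 1)
    (h : ∀ g, S.mat g = P * R.mat g * Q) : S.casimir = P * R.casimir * Q := by
  simp only [casimir, deriv_conj h, Matrix.mul_sum, Matrix.sum_mul]
  refine Finset.sum_congr rfl fun i _ => ?_
  simp only [Matrix.mul_assoc]
  rw [← Matrix.mul_assoc Q P, hQP, Matrix.one_mul]

lemma exp_conj_rect {m n : ℕ} {P : Matrix (Fin m) (Fin n) ℂ} {Q : Matrix (Fin n) (Fin m) ℂ}
    (hPQ : P * Q = 1) (hQP : Q * P = 1) (A : Matrix (Fin n) (Fin n) ℂ) :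
    NormedSpace.exp (P * A * Q) = P * NormedSpace.exp A * Q := by
  let f : Matrix (Fin n) (Fin n) ℂ →+* Matrix (Fin m) (Fin m) ℂ :=
    { toFun := fun B => P * B * Q
      map_one' := by rw [Matrix.mul_one, hPQ]
      map_mul' := fun B C => by
        simp only [Matrix.mul_assoc]
        rw [← Matrix.mul_assoc Q P, hQP, Matrix.one_mul]
      map_zero' := by simp
      map_add' := fun B C => by rw [Matrix.mul_add, Matrix.add_mul] }
  let _ : NormedRing (Matrix (Fin n) (Fin n) ℂ) := Matrix.linftyOpNormedRing
  let _ : NormedAlgebra ℂ (Matrix (Fin n) (Fin n) ℂ) := Matrix.linftyOpNormedAlgebra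
  let _ : NormedAlgebra ℚ (Matrix (Fin n) (Fin n) ℂ) := NormedAlgebra.restrictScalars ℚ ℂ _
  let _ : NormedRing (Matrix (Fin m) (Fin m) ℂ) := Matrix.linftyOpNormedRing
  let _ : NormedAlgebra ℂ (Matrix (Fin m) (Fin m) ℂ) := Matrix.linftyOpNormedAlgebra
  let _ : NormedAlgebra ℚ (Matrix (Fin m) (Fin m) ℂ) := NormedAlgebra.restrictScalars ℚ ℂ _
  have hf : Continuous f :=
    (continuous_const.matrix_mul continuous_id).matrix_mul continuous_const
  exact (NormedSpace.map_exp f hf A).symm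

lemma heat_conj (g a : ℝ) {R S : MatRep (SU N)} {P : Matrix (Fin S.dim) (Fin R.dim) ℂ}
    {Q : Matrix (Fin R.dim) (Fin S.dim) ℂ} (hPQ : P * Q = 1) (hQP : Q * P = 1)
    (h : ∀ g, S.mat g = P * R.mat g * Q) : S.heat g a = P * R.heat g a * Q := by
  rw [heat, casimir_conj hQP h, heat, ← exp_conj_rect hPQ hQP]
  simp

lemma deriv_sum (R S : MatRep (SU N)) (X : su N) :
    (R.sum S).deriv X = reindex finSumFinEquiv finSumFinEquiv
      (fromBlocks (R.deriv X) 0 0 (S.deriv X)) := by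
  ext i j
  obtain ⟨i, rfl⟩ := finSumFinEquiv.surjective i
  obtain ⟨j, rfl⟩ := finSumFinEquiv.surjective j
  have h : (fun t : ℝ => (R.sum S).mat (su.exp X t) (finSumFinEquiv i) (finSumFinEquiv j)) =
      fun t : ℝ => fromBlocks (R.mat (su.exp X t)) 0 0 (S.mat (su.exp X t)) i j := by
    funext t
    change fromBlocks (R.mat (su.exp X t)) 0 0 (S.mat (su.exp X t))
      (finSumFinEquiv.symm (finSumFinEquiv i)) (finSumFinEquiv.symm (finSumFinEquiv j)) = _
    simp only [Equiv.symm_apply_apply]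
  change _root_.deriv (fun t : ℝ => (R.sum S).mat (su.exp X t) (finSumFinEquiv i)
    (finSumFinEquiv j)) 0 = _
  rw [h]
  simp only [reindex_apply, submatrix_apply, Equiv.symm_apply_apply]
  rcases i with i | i <;> rcases j with j | j <;> simp [deriv]

lemma reindex_block_mul {m n : ℕ} (A A' : Matrix (Fin m) (Fin m) ℂ)
    (B B' : Matrix (Fin n) (Fin n) ℂ) :
    reindex finSumFinEquiv finSumFinEquiv (fromBlocks A 0 0 B) *
      reindex finSumFinEquiv finSumFinEquiv (fromBlocks A' 0 0 B') =
    reindex finSumFinEquiv finSumFinEquiv (fromBlocks (A * A') 0 0 (B * B')) := by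
  simp [fromBlocks_multiply, submatrix_mul_equiv]

lemma reindex_block_smul {m n : ℕ} (c : ℂ) (A : Matrix (Fin m) (Fin m) ℂ)
    (B : Matrix (Fin n) (Fin n) ℂ) :
    c • reindex finSumFinEquiv finSumFinEquiv (fromBlocks A 0 0 B) =
      reindex finSumFinEquiv finSumFinEquiv (fromBlocks (c • A) 0 0 (c • B)) := by
  rw [← coe_reindexLinearEquiv ℂ ℂ, ← map_smul, fromBlocks_smul]
  simp

lemma casimir_sum (R S : MatRep (SU N)) :
    (R.sum S).casimir = reindex finSumFinEquiv finSumFinEquiv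
      (fromBlocks R.casimir 0 0 S.casimir) := by
  have hs : ∀ (s : Finset (Fin (Module.finrank ℝ (su N))))
      (f : _ → Matrix (Fin R.dim) (Fin R.dim) ℂ) (f' : _ → Matrix (Fin S.dim) (Fin S.dim) ℂ),
      ∑ i ∈ s, fromBlocks (f i) 0 0 (f' i) = fromBlocks (∑ i ∈ s, f i) 0 0 (∑ i ∈ s, f' i) := by
    intro s f f'
    ext i j
    rcases i with i | i <;> rcases j with j | j <;> simp [Matrix.sum_apply]
  rw [casimir, casimir, casimir, ← hs]
  simp only [deriv_sum]
  rw [← coe_reindexLinearEquiv ℂ ℂ, map_sum]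
  refine Finset.sum_congr rfl fun i _ => ?_
  exact reindex_block_mul _ _ _ _

lemma heat_sum (g a : ℝ) (R S : MatRep (SU N)) :
    (R.sum S).heat g a = reindex finSumFinEquiv finSumFinEquiv
      (fromBlocks (R.heat g a) 0 0 (S.heat g a)) := by
  let f : Matrix (Fin R.dim) (Fin R.dim) ℂ × Matrix (Fin S.dim) (Fin S.dim) ℂ →+*
      Matrix (Fin (R.dim + S.dim)) (Fin (R.dim + S.dim)) ℂ :=
    { toFun := fun B => reindex finSumFinEquiv finSumFinEquiv (fromBlocks B.1 0 0 B.2)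
      map_one' := by simp
      map_mul' := fun B C => by simp [fromBlocks_multiply, submatrix_mul_equiv]
      map_zero' := by simp
      map_add' := fun B C => by
        rw [← coe_reindexLinearEquiv ℂ ℂ, ← map_add]
        simp [fromBlocks_add] }
  let _ : NormedRing (Matrix (Fin R.dim) (Fin R.dim) ℂ) := Matrix.linftyOpNormedRing
  let _ : NormedAlgebra ℂ (Matrix (Fin R.dim) (Fin R.dim) ℂ) := Matrix.linftyOpNormedAlgebra
  let _ : NormedAlgebra ℚ (Matrix (Fin R.dim) (Fin R.dim) ℂ) :=
    NormedAlgebra.restrictScalars ℚ ℂ _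
  let _ : NormedRing (Matrix (Fin S.dim) (Fin S.dim) ℂ) := Matrix.linftyOpNormedRing
  let _ : NormedAlgebra ℂ (Matrix (Fin S.dim) (Fin S.dim) ℂ) := Matrix.linftyOpNormedAlgebra
  let _ : NormedAlgebra ℚ (Matrix (Fin S.dim) (Fin S.dim) ℂ) :=
    NormedAlgebra.restrictScalars ℚ ℂ _
  let _ : NormedRing (Matrix (Fin (R.dim + S.dim)) (Fin (R.dim + S.dim)) ℂ) :=
    Matrix.linftyOpNormedRing
  let _ : NormedAlgebra ℂ (Matrix (Fin (R.dim + S.dim)) (Fin (R.dim + S.dim)) ℂ) :=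
    Matrix.linftyOpNormedAlgebra
  let _ : NormedAlgebra ℚ (Matrix (Fin (R.dim + S.dim)) (Fin (R.dim + S.dim)) ℂ) :=
    NormedAlgebra.restrictScalars ℚ ℂ _
  have hf : Continuous f :=
    Continuous.matrix_submatrix (Continuous.matrix_fromBlocks continuous_fst continuous_const
      continuous_const continuous_snd) finSumFinEquiv.symm finSumFinEquiv.symm
  have h := NormedSpace.map_exp f hf
    (-((g ^ 2 * a / 2 : ℝ) : ℂ) • R.casimir, -((g ^ 2 * a / 2 : ℝ) : ℂ) • S.casimir)
  have h1 : NormedSpace.exp (-((g ^ 2 * a / 2 : ℝ) : ℂ) • R.casimir,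
      -((g ^ 2 * a / 2 : ℝ) : ℂ) • S.casimir) = (R.heat g a, S.heat g a) :=
    Prod.ext (Prod.fst_exp _) (Prod.snd_exp _)
  refine Eq.trans ?_ (h.symm.trans (congrArg f h1))
  rw [heat, casimir_sum]
  congr 1
  exact reindex_block_smul _ _ _

end MatRep

/-! ## Correlators of Wilson loops and topological point operators -/

/-- The direction of a Wilson loop that runs along the boundary of a surface. -/
inductive LoopDir
  /-- against the orientation induced on the boundary -/
  | opposite
  /-- along the orientation induced on the boundary -/
  | along

/-- The holonomy along the loop, given the holonomy `U` against the boundary orientation. -/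
def LoopDir.hol {N : ℕ} : LoopDir → SU N → SU N
  | .opposite, U => U
  | .along, U => U⁻¹

/-- The holonomy data of a connection on a surface of genus `p` with one boundary circle and
one puncture: the parallel transport from the base point to the puncture and the holonomies
around the handles. -/
abbrev HolData (N p : ℕ) : Type := SU N × (Fin p → SU N × SU N)

/-- The normalized Haar measure on the holonomy data. -/
def holMeasure (N p : ℕ) : Measure (HolData N p) :=
  (SU.haar N).prod (Measure.pi fun _ => (SU.haar N).prod (SU.haar N))

/-- The boundary holonomy `h⁻¹ U h [A₁, B₁] ⋯ [A_p, B_p]`, when the holonomy around the puncture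
is `U` up to conjugation; the fluctuation of the holonomy over the area of the surface is accounted
for by `MatRep.heat`. -/
def boundaryHol {N p : ℕ} (U : SU N) (z : HolData N p) : SU N :=
  z.1⁻¹ * U * z.1 * (List.ofFn fun i => (z.2 i).1 * (z.2 i).2 * (z.2 i).1⁻¹ * (z.2 i).2⁻¹).prod

/-- The correlator `⟨V[U] W_R⟩` of two-dimensional `SU(N)` Yang–Mills theory with coupling `g` on
a surface of area `a` and genus `p` with one boundary circle, along which the Wilson loop `W_R`
runs, and with the operator `V[U]` inserted at an interior point: there the holonomy of the
connection is prescribed to lie in the conjugacy class of `U`. The disk of area `1 / 2` is the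
case `p = 0`, `a = 1 / 2`. -/
def corrRep {N : ℕ} (g a : ℝ) (p : ℕ) (d : LoopDir) (U : SU N) (R : MatRep (SU N)) : ℂ :=
  ∫ z : HolData N p, (R.mat (d.hol (boundaryHol U z)) * R.heat g a).trace ∂(holMeasure N p)

section

variable {N : ℕ} (g a : ℝ) (p : ℕ) (d : LoopDir)

lemma continuous_boundaryHol (U : SU N) :
    Continuous fun z : HolData N p => boundaryHol U z := by
  unfold boundaryHol
  refine Continuous.mul (by fun_prop) ?_
  simp only [List.ofFn_eq_map]
  exact continuous_list_prod _ fun i _ => by fun_prop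

lemma integrable_corr (U : SU N) (R : MatRep (SU N)) :
    Integrable (fun z : HolData N p => (R.mat (d.hol (boundaryHol U z)) * R.heat g a).trace)
      (holMeasure N p) := by
  have hc : Continuous fun z : HolData N p =>
      (R.mat (d.hol (boundaryHol U z)) * R.heat g a).trace := by
    have h1 : Continuous fun z : HolData N p => d.hol (boundaryHol U z) := by
      cases d
      · exact continuous_boundaryHol p U
      · exact (continuous_boundaryHol p U).inv
    have h2 := R.continuous_mat.comp h1
    exact Continuous.matrix_trace (h2.matrix_mul continuous_const)
  have hfin : IsFiniteMeasure (holMeasure N p) := by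
    unfold holMeasure
    infer_instance
  exact hc.integrable_of_hasCompactSupport (HasCompactSupport.of_compactSpace _)

lemma corrRep_iso (U : SU N) {R S : MatRep (SU N)} (h : R.Iso S) :
    corrRep g a p d U R = corrRep g a p d U S := by
  obtain ⟨P, Q, h1, h2, h3⟩ := MatRep.iso_iff_sim.mp h
  have h4 : ∀ g, S.mat g = P * R.mat g * Q := fun g => Sim.eq_conj h1 (h3 g)
  unfold corrRep
  refine congrArg _ (funext fun z => ?_)
  rw [MatRep.heat_conj g a h1 h2 h4, h4]
  set A := R.mat (d.hol (boundaryHol U z))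
  set B := R.heat g a
  have : P * A * Q * (P * B * Q) = P * (A * B * Q) := by
    simp only [Matrix.mul_assoc]
    rw [← Matrix.mul_assoc Q P, h2, Matrix.one_mul]
  rw [this, Matrix.trace_mul_comm P, Matrix.mul_assoc, h2, Matrix.mul_one]

lemma corrRep_zero (U : SU N) : corrRep g a p d U (MatRep.zero (SU N)) = 0 := by
  have : IsEmpty (Fin (MatRep.zero (SU N)).dim) := Fin.isEmpty
  simp [corrRep, Matrix.trace]

lemma corrRep_sum (U : SU N) (R S : MatRep (SU N)) :
    corrRep g a p d U (R.sum S) = corrRep g a p d U R + corrRep g a p d U S := by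
  unfold corrRep
  rw [← integral_add (integrable_corr g a p d U R) (integrable_corr g a p d U S)]
  refine congrArg _ (funext fun z => ?_)
  rw [MatRep.heat_sum]
  change ((reindex finSumFinEquiv finSumFinEquiv (fromBlocks (R.mat _) 0 0 (S.mat _))) *
    reindex finSumFinEquiv finSumFinEquiv _).trace = _
  have htr : ∀ M : Matrix (Fin R.dim ⊕ Fin S.dim) (Fin R.dim ⊕ Fin S.dim) ℂ,
      (M.submatrix finSumFinEquiv.symm finSumFinEquiv.symm).trace = M.trace := fun M =>
    Equiv.sum_comp finSumFinEquiv.symm fun i => M i i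
  simp only [reindex_apply, submatrix_mul_equiv, fromBlocks_multiply, htr]
  simp [Matrix.trace]

lemma corrRep_conj (k U : SU N) (R : MatRep (SU N)) :
    corrRep g a p d (k * U * k⁻¹) R = corrRep g a p d U R := by
  have hinv : (holMeasure N p).IsMulLeftInvariant := by
    have h1 : ((SU.haar N).prod (SU.haar N)).IsMulLeftInvariant := inferInstance
    have h2 : (Measure.pi fun _ : Fin p =>
        (SU.haar N).prod (SU.haar N)).IsMulLeftInvariant := Measure.pi.isMulLeftInvariant _
    exact Measure.prod.instIsMulLeftInvariant
  unfold corrRep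
  rw [← integral_mul_left_eq_self (fun z : HolData N p =>
    (R.mat (d.hol (boundaryHol U z)) * R.heat g a).trace) (k⁻¹, 1)]
  refine congrArg _ (funext fun z => ?_)
  have : boundaryHol (k * U * k⁻¹) z = boundaryHol U ((k⁻¹, 1) * z) := by
    simp [boundaryHol, mul_assoc]
  rw [this]

/-- The correlator `⟨V[U] W_R⟩` as a function of the isomorphism class of `R`. -/
def corrClass (U : SU N) : RepClass (SU N) →+ ℂ where
  toFun := Quotient.lift (corrRep g a p d U) fun _ _ h => corrRep_iso g a p d U h
  map_zero' := corrRep_zero g a p d U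
  map_add' := by
    rintro ⟨R⟩ ⟨S⟩
    exact corrRep_sum g a p d U R S

lemma corrClass_conj (k U : SU N) :
    corrClass g a p d (k * U * k⁻¹) = corrClass g a p d U := by
  refine DFunLike.ext _ _ ?_
  rintro ⟨R⟩
  exact corrRep_conj g a p d k U R

/-- The pairing `⟨c, x⟩ = ⟨V[c] W_x⟩` between conjugacy classes of `SU(N)`, which label the
topological point operators, and the Grothendieck ring, whose elements label the Wilson loops:
the additive extension of the correlator `corrRep`. -/
def corr (c : ConjClasses (SU N)) : RepRing (SU N) →+ ℂ :=
  RepRing.lift (Quotient.lift (corrClass g a p d) (fun U U' h => by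
    obtain ⟨k, rfl⟩ := isConj_iff.mp h
    exact (corrClass_conj g a p d k U).symm) c)

/-- The pairing `⟨x | y⟩` on the Grothendieck ring, obtained by integrating over the insertions
of topological point operators. -/
def pairing (x y : RepRing (SU N)) : ℂ :=
  ∫ U, corr g a p d (ConjClasses.mk U) x * corr g a p d (ConjClasses.mk U) y ∂(SU.haar N)

/-- Gauging the non-invertible 1-form symmetry with generalized theta-angle `κ`: the
integral over the insertions of all topological point operators `V[U]`, weighted by the
character of `κ`. -/
def gauged (κ : MatRep (SU N)) (x : RepRing (SU N)) : ℂ :=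
  ∫ U, κ.char U * corr g a p d (ConjClasses.mk U) x ∂(SU.haar N)

end

/-- The weight `(dim R)^(-2p) exp (-(g² a / 2) C₂(R))` of the sector `R` on a surface of area `a`
and genus `p` with one boundary circle. -/
def weight {N : ℕ} (g a : ℝ) (p : ℕ) (R : MatRep (SU N)) : ℝ :=
  ((R.dim : ℝ) ^ (2 * p))⁻¹ * Real.exp (-(g ^ 2 * a / 2) * R.C2)

/-- The representation selected by gauging with theta-angle `κ`. -/
def LoopDir.selected {N : ℕ} : LoopDir → MatRep (SU N) → MatRep (SU N)
  | .opposite, κ => κ.conj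
  | .along, κ => κ

end YM

end

open YM

/-! Everything reduces to Schur's lemma, once the Casimir operator is known to be a real scalar on
irreducible representations.

The derived representation is linear although only continuity of $R$ is assumed: applying $R$ to the
Lie product formula in $\mathrm{SU}(N)$ yields the product formula for the generators
(`MatRep.deriv_add`). The sum defining the Casimir operator is contracted with a basis and its dual
basis, hence does not change under isometries of the form (`sum_dualBasis_isometry`). The adjoint
action is isometric, so $\Omega_R$ commutes with $R$ (`MatRep.casimir_comm`) and is a scalar for
irreducible $R$. The scalar is real because an invariant Hermitian form makes $R$ isomorphic to its
Hermitian dual (`MatRep.trace_casimir_eq_re`). Hence the propagator is the number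
$\mathrm{e}^{-\frac{g^2a}{2}C_2(R)}$.

Averaging over Haar measure turns any matrix into an intertwiner, and Schur's lemma then gives
orthogonality of matrix entries. By this orthogonality each commutator $ABA^{-1}B^{-1}$ averages to
$(\dim R)^{-2}$, so $p$ handles contribute $(\dim R)^{-2p}$, and the trace removes the conjugation
by $h$. This is `corr_cls_irreducible`. The pairing and the gauging of irreducible classes are then
character integrals with values $0$ or $1$, times weights.

The passage to arbitrary $x$ rests on complete reducibility: irreducible classes generate the
Grothendieck ring (`RepRing.induction_irreducible`). In particular the gauging is an integer
multiple of the nonzero number $w(\kappa)$. This integer is additive in $x$, and the projector is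
$x\mapsto n(x)[\kappa^*]$. -/

noncomputable section

set_option linter.unusedSectionVars false

namespace YM

/-! ### Powers of a curve through the identity. -/

section PowerLimit

open Filter Topology

lemma norm_pow_sub_pow_le_mul {A : Type*} [NormedRing A] {u v : A} {M : ℝ} (hM : 1 ≤ M)
    (hu : ‖u‖ ≤ M) (hv : ‖v‖ ≤ M) (n : ℕ) : ‖u ^ n - v ^ n‖ ≤ n * M ^ n * ‖u - v‖ := by
  have hM0 : 0 ≤ M := zero_le_one.trans hM
  have hmul : ∀ k : ℕ, ‖(u - v) * v ^ k‖ ≤ ‖u - v‖ * M ^ k := by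
    intro k
    induction k with
    | zero => simp
    | succ k ih =>
      rw [pow_succ, ← mul_assoc, pow_succ, ← mul_assoc]
      exact (norm_mul_le _ _).trans (mul_le_mul ih hv (norm_nonneg _) (by positivity))
  induction n with
  | zero => simp
  | succ n ih =>
    have h1 : u ^ (n + 1) - v ^ (n + 1) = u * (u ^ n - v ^ n) + (u - v) * v ^ n := by
      rw [pow_succ', pow_succ']; noncomm_ring
    have h2 : ‖u * (u ^ n - v ^ n)‖ ≤ M * (n * M ^ n * ‖u - v‖) :=
      (norm_mul_le _ _).trans (mul_le_mul hu ih (norm_nonneg _) hM0)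
    have h3 : ‖u - v‖ * M ^ n ≤ ‖u - v‖ * M ^ (n + 1) :=
      mul_le_mul_of_nonneg_left (pow_le_pow_right₀ hM n.le_succ) (norm_nonneg _)
    rw [h1]
    have h4 := add_le_add h2 ((hmul n).trans h3)
    refine (norm_add_le _ _).trans (h4.trans (le_of_eq ?_))
    push_cast
    ring

/-- If a curve passes through `1` with velocity `Z`, then the powers `γ(1/n)ⁿ` converge to the
exponential of `Z`. -/
lemma tendsto_pow_exp_of_hasDerivAt {A : Type*} [NormedRing A] [NormedAlgebra ℝ A]
    [CompleteSpace A] (hone : ‖(1 : A)‖ ≤ 1) {γ : ℝ → A} {Z : A} (h0 : γ 0 = 1)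
    (hγ : HasDerivAt γ Z 0) :
    Tendsto (fun n : ℕ => γ ((n : ℝ)⁻¹) ^ n) atTop (𝓝 (NormedSpace.exp Z)) := by
  let _ : NormedAlgebra ℚ A := NormedAlgebra.restrictScalars ℚ ℝ A
  have hinv : Tendsto (fun n : ℕ => ((n : ℝ)⁻¹)) atTop (𝓝 0) := tendsto_inv_atTop_nhds_zero_nat
  have hE : HasDerivAt (fun s : ℝ => NormedSpace.exp (s • Z)) Z 0 := by
    simpa using hasDerivAt_exp_smul_const Z (0 : ℝ)
  -- The remainder of the first-order expansion is eventually at most `1 * |s|`; this is the `1`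
  -- added to `‖Z‖`. The estimate serves both `γ` and `s ↦ exp (s Z)`.
  have bound : ∀ {δ : ℝ → A}, δ 0 = 1 → HasDerivAt δ Z 0 →
      ∀ᶠ n : ℕ in atTop, ‖δ ((n : ℝ)⁻¹)‖ ≤ 1 + (‖Z‖ + 1) * (n : ℝ)⁻¹ := by
    intro δ hδ0 hδ
    have h1 : ∀ᶠ s in 𝓝 (0 : ℝ), ‖δ s - δ 0 - (s - 0) • Z‖ ≤ 1 * ‖s - 0‖ :=
      (hasDerivAt_iff_isLittleO.mp hδ).def one_pos
    filter_upwards [hinv.eventually h1] with n hn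
    have hpos : (0 : ℝ) ≤ (n : ℝ)⁻¹ := by positivity
    have h2 : δ ((n : ℝ)⁻¹) =
        (δ ((n : ℝ)⁻¹) - δ 0 - ((n : ℝ)⁻¹ - 0) • Z) + (1 + (n : ℝ)⁻¹ • Z) := by
      rw [hδ0, sub_zero]; abel
    rw [sub_zero, Real.norm_of_nonneg hpos] at hn
    rw [h2, sub_zero]
    have h3 := add_le_add hn (norm_add_le (1 : A) ((n : ℝ)⁻¹ • Z))
    refine (norm_add_le _ _).trans (h3.trans ?_)
    rw [norm_smul, Real.norm_of_nonneg hpos]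
    nlinarith
  -- The two curves agree at `0` to first order, so their difference at `1/n` is `o(1/n)`. This
  -- beats the factor `n` lost when passing to `n`-th powers.
  have hdiff : Tendsto (fun n : ℕ => (n : ℝ) *
      ‖γ ((n : ℝ)⁻¹) - NormedSpace.exp ((n : ℝ)⁻¹ • Z)‖) atTop (𝓝 0) := by
    have h1 := (hγ.sub hE).tendsto_slope_zero
    have h2 : Tendsto (fun n : ℕ => ((n : ℝ)⁻¹)) atTop (𝓝[≠] 0) :=
      tendsto_nhdsWithin_iff.mpr ⟨hinv, by
        filter_upwards [eventually_gt_atTop 0] with n hn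
        simpa using hn.ne'⟩
    have h3 := (h1.comp h2).norm
    simp only [sub_self, norm_zero] at h3
    refine h3.congr fun n => ?_
    simp [norm_smul, h0]
  have hlim : Tendsto (fun n : ℕ => Real.exp (‖Z‖ + 1) * ((n : ℝ) *
      ‖γ ((n : ℝ)⁻¹) - NormedSpace.exp ((n : ℝ)⁻¹ • Z)‖)) atTop (𝓝 0) := by
    simpa using hdiff.const_mul (Real.exp (‖Z‖ + 1))
  rw [tendsto_iff_norm_sub_tendsto_zero]
  refine squeeze_zero' (Eventually.of_forall fun _ => norm_nonneg _) ?_ hlim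
  filter_upwards [bound h0 hγ, bound (by simp) hE, eventually_gt_atTop 0] with n h1 h2 hn
  have hn' : (n : ℝ) ≠ 0 := by positivity
  have hexp : NormedSpace.exp Z = NormedSpace.exp ((n : ℝ)⁻¹ • Z) ^ n := by
    rw [← NormedSpace.exp_nsmul, ← Nat.cast_smul_eq_nsmul ℝ, smul_smul, mul_inv_cancel₀ hn',
      one_smul]
  -- The factor `M ^ n` in `norm_pow_sub_pow_le_mul` stays bounded in `n`, since `1 + x ≤ exp x`.
  have hM : (1 + (‖Z‖ + 1) * (n : ℝ)⁻¹) ^ n ≤ Real.exp (‖Z‖ + 1) := by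
    have h3 : 1 + (‖Z‖ + 1) * (n : ℝ)⁻¹ ≤ Real.exp ((‖Z‖ + 1) * (n : ℝ)⁻¹) := by
      rw [add_comm]; exact Real.add_one_le_exp _
    refine (pow_le_pow_left₀ (by positivity) h3 n).trans (le_of_eq ?_)
    rw [← Real.exp_nat_mul]
    congr 1
    field_simp
  rw [hexp]
  refine (norm_pow_sub_pow_le_mul (le_add_of_nonneg_right (by positivity)) h1 h2 n).trans ?_
  rw [mul_comm (n : ℝ), mul_assoc]
  exact mul_le_mul_of_nonneg_right hM (by positivity)

end PowerLimit

/-! ### The invariant form and the adjoint action. -/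

/-- The canonical element of a nondegenerate form is invariant under isometries. -/
lemma sum_dualBasis_isometry {V M ι : Type*} [AddCommGroup V] [Module ℝ V] [AddCommGroup M]
    [Module ℝ M] [Fintype ι] [DecidableEq ι] {B : LinearMap.BilinForm ℝ V} (hB : B.Nondegenerate)
    (b : Module.Basis ι ℝ V) (β : V →ₗ[ℝ] V →ₗ[ℝ] M) (T : V ≃ₗ[ℝ] V)
    (hT : ∀ x y, B (T x) (T y) = B x y) :
    ∑ i, β (T (b i)) (T (B.dualBasis hB b i)) = ∑ i, β (b i) (B.dualBasis hB b i) := by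
  set c := B.dualBasis hB b with hc
  have hexp : ∀ y, ∑ i, B y (b i) • c i = y := fun y => by
    simpa only [hc, LinearMap.BilinForm.dualBasis_repr_apply] using c.sum_repr y
  have hexp' : ∀ x, ∑ j, B (c j) x • b j = x := fun x => by
    refine (Finset.sum_congr rfl fun j _ => ?_).trans (b.sum_repr x)
    congr 1
    calc B (c j) x = B (c j) (∑ i, b.repr x i • b i) := by rw [b.sum_repr]
      _ = b.repr x j := by
        simp only [map_sum, map_smul, hc, LinearMap.BilinForm.apply_dualBasis_left]
        simp
  -- The isometry moves `T` to the other argument as `T.symm`; the expansion in `b` then recovers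
  -- `T.symm (b i)`, and `T` undoes it.
  have hinv : ∀ i, ∑ j, B (T (c j)) (b i) • T (b j) = b i := fun i => by
    have h : ∀ j, B (T (c j)) (b i) = B (c j) (T.symm (b i)) := fun j => by
      conv_lhs => rw [← T.apply_symm_apply (b i)]
      exact hT _ _
    simp only [h, ← map_smul, ← map_sum, hexp', T.apply_symm_apply]
  -- Only `T (c j)` is expanded, in the basis `c`; its coefficients are exactly those that
  -- reassemble the vectors `T (b j)` into `b i`.
  calc ∑ j, β (T (b j)) (T (c j))
      = ∑ j, ∑ i, B (T (c j)) (b i) • β (T (b j)) (c i) := by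
        refine Finset.sum_congr rfl fun j _ => ?_
        conv_lhs => rw [← hexp (T (c j))]
        simp only [map_sum, map_smul]
    _ = ∑ i, β (b i) (c i) := by
        rw [Finset.sum_comm]
        refine Finset.sum_congr rfl fun i _ => ?_
        conv_rhs => rw [← hinv i]
        simp

namespace su

variable {N : ℕ}

lemma conj_mem (U : SU N) {X : Matrix (Fin N) (Fin N) ℂ} (hX : X ∈ su N) :
    (U : Matrix (Fin N) (Fin N) ℂ) * X * ((U⁻¹ : SU N) : Matrix (Fin N) (Fin N) ℂ) ∈ su N := by
  have hU : ((U⁻¹ : SU N) : Matrix (Fin N) (Fin N) ℂ) = (U : Matrix (Fin N) (Fin N) ℂ)ᴴ := rfl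
  have hUU : (U : Matrix (Fin N) (Fin N) ℂ)ᴴ * U = 1 :=
    congrArg Subtype.val (inv_mul_cancel U)
  rw [hU]
  refine ⟨?_, ?_⟩
  · simp only [conjTranspose_mul, conjTranspose_conjTranspose, hX.1]
    simp [Matrix.mul_assoc]
  · rw [Matrix.trace_mul_comm, ← Matrix.mul_assoc, hUU, Matrix.one_mul, hX.2]

/-- The adjoint action of `SU(N)` on `𝔰𝔲(N)`. -/
def ad (U : SU N) : su N ≃ₗ[ℝ] su N where
  toFun X := ⟨(U : Matrix (Fin N) (Fin N) ℂ) * X * ((U⁻¹ : SU N) : Matrix (Fin N) (Fin N) ℂ),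
    conj_mem U X.2⟩
  map_add' X Y := Subtype.ext (by simp [mul_add, add_mul])
  map_smul' c X := Subtype.ext (by simp)
  invFun X := ⟨((U⁻¹ : SU N) : Matrix (Fin N) (Fin N) ℂ) * X * (U : Matrix (Fin N) (Fin N) ℂ),
    by simpa using conj_mem U⁻¹ X.2⟩
  left_inv X := Subtype.ext (by
    have h : ((U⁻¹ : SU N) : Matrix (Fin N) (Fin N) ℂ) * U = 1 :=
      congrArg Subtype.val (inv_mul_cancel U)
    simp only [Matrix.mul_assoc, h, Matrix.mul_one]
    rw [← Matrix.mul_assoc, h, Matrix.one_mul])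
  right_inv X := Subtype.ext (by
    have h : (U : Matrix (Fin N) (Fin N) ℂ) * ((U⁻¹ : SU N) : Matrix (Fin N) (Fin N) ℂ) = 1 :=
      congrArg Subtype.val (mul_inv_cancel U)
    simp only [Matrix.mul_assoc, h, Matrix.mul_one]
    rw [← Matrix.mul_assoc, h, Matrix.one_mul])

lemma coe_ad (U : SU N) (X : su N) : (ad U X : Matrix (Fin N) (Fin N) ℂ) =
    (U : Matrix (Fin N) (Fin N) ℂ) * X * ((U⁻¹ : SU N) : Matrix (Fin N) (Fin N) ℂ) := rfl

lemma form_ad (U : SU N) (X Y : su N) : form N (ad U X) (ad U Y) = form N X Y := by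
  have h : ((U⁻¹ : SU N) : Matrix (Fin N) (Fin N) ℂ) * U = 1 :=
    congrArg Subtype.val (inv_mul_cancel U)
  change (((ad U X : Matrix (Fin N) (Fin N) ℂ) * (ad U Y : Matrix (Fin N) (Fin N) ℂ)).trace).re
    = (((X : Matrix (Fin N) (Fin N) ℂ) * (Y : Matrix (Fin N) (Fin N) ℂ)).trace).re
  rw [coe_ad, coe_ad, ← Matrix.mul_assoc, Matrix.trace_mul_comm]
  simp only [← Matrix.mul_assoc, h, Matrix.one_mul]
  rw [Matrix.mul_assoc (X : Matrix (Fin N) (Fin N) ℂ), h, Matrix.mul_one]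

lemma exp_ad (U : SU N) (X : su N) (t : ℝ) : exp (ad U X) t = U * exp X t * U⁻¹ := by
  apply Subtype.ext
  change NormedSpace.exp (t • (ad U X : Matrix (Fin N) (Fin N) ℂ)) =
    (U : Matrix (Fin N) (Fin N) ℂ) * NormedSpace.exp (t • (X : Matrix (Fin N) (Fin N) ℂ)) *
      ((U⁻¹ : SU N) : Matrix (Fin N) (Fin N) ℂ)
  rw [← MatRep.exp_conj_rect (congrArg Subtype.val (mul_inv_cancel U))
    (congrArg Subtype.val (inv_mul_cancel U)), coe_ad, Matrix.mul_smul, Matrix.smul_mul]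

lemma exp_smul (c : ℝ) (X : su N) (t : ℝ) : exp (c • X) t = exp X (c * t) := by
  apply Subtype.ext
  change NormedSpace.exp (t • (c • (X : Matrix (Fin N) (Fin N) ℂ))) = NormedSpace.exp (_ • _)
  rw [smul_smul, mul_comm]

end su

/-! ### The derived representation and the invariance of the Casimir operator. -/

section OneParameterSubgroups

attribute [local instance] Matrix.linftyOpNormedRing Matrix.linftyOpNormedAlgebra

open Filter Topology

/-- An inequality, because for `n = 0` the matrix ring is trivial and its unit has norm `0`. -/
lemma norm_one_matrix_le (n : ℕ) : ‖(1 : Matrix (Fin n) (Fin n) ℂ)‖ ≤ 1 := by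
  rcases isEmpty_or_nonempty (Fin n) with h | h
  · rw [Subsingleton.elim (1 : Matrix (Fin n) (Fin n) ℂ) 0, norm_zero]
    exact zero_le_one
  · have : NormOneClass (Matrix (Fin n) (Fin n) ℂ) := Matrix.linfty_opNormOneClass
    exact norm_one.le

namespace su

variable {N : ℕ}

lemma hasDerivAt_coe_exp (X : su N) :
    HasDerivAt (fun t : ℝ => (exp X t : Matrix (Fin N) (Fin N) ℂ))
      (X : Matrix (Fin N) (Fin N) ℂ) 0 := by
  have : CompleteSpace (Matrix (Fin N) (Fin N) ℂ) := FiniteDimensional.complete ℝ _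
  have h := hasDerivAt_exp_smul_const (X : Matrix (Fin N) (Fin N) ℂ) (0 : ℝ)
  rw [zero_smul, NormedSpace.exp_zero, one_mul] at h
  exact h

/-- The Lie product formula in `SU(N)`. -/
lemma tendsto_exp_mul_exp_pow (X Y : su N) (t : ℝ) :
    Tendsto (fun n : ℕ => (exp X (t * (n : ℝ)⁻¹) * exp Y (t * (n : ℝ)⁻¹)) ^ n) atTop
      (𝓝 (exp (X + Y) t)) := by
  have : CompleteSpace (Matrix (Fin N) (Fin N) ℂ) := FiniteDimensional.complete ℝ _
  rw [tendsto_subtype_rng]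
  have hs : HasDerivAt (fun s : ℝ => t * s) t 0 := by
    simpa using (hasDerivAt_id (0 : ℝ)).const_mul t
  have hX : HasDerivAt (fun s : ℝ => (exp X (t * s) : Matrix (Fin N) (Fin N) ℂ))
      (t • (X : Matrix (Fin N) (Fin N) ℂ)) 0 :=
    HasDerivAt.scomp_of_eq (0 : ℝ) (hasDerivAt_coe_exp X) hs (by simp)
  have hY : HasDerivAt (fun s : ℝ => (exp Y (t * s) : Matrix (Fin N) (Fin N) ℂ))
      (t • (Y : Matrix (Fin N) (Fin N) ℂ)) 0 :=
    HasDerivAt.scomp_of_eq (0 : ℝ) (hasDerivAt_coe_exp Y) hs (by simp)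
  -- By the product rule the curve `s ↦ exp X (t s) * exp Y (t s)` has velocity `t (X + Y)` at `0`,
  -- so the limit of its powers is known.
  have h := hX.mul hY
  have h2 := tendsto_pow_exp_of_hasDerivAt (norm_one_matrix_le N) (by simp [exp_zero]) h
  have h3 : t • (X : Matrix (Fin N) (Fin N) ℂ) * (exp Y (t * 0) : Matrix (Fin N) (Fin N) ℂ) +
      (exp X (t * 0) : Matrix (Fin N) (Fin N) ℂ) * t • (Y : Matrix (Fin N) (Fin N) ℂ) =
      t • ((X + Y : su N) : Matrix (Fin N) (Fin N) ℂ) := by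
    simp [exp_zero]
  rw [h3] at h2
  exact h2

end su

namespace MatRep

variable {N : ℕ} (R : MatRep (SU N))

/-- `deriv` is defined entry by entry; here it becomes a derivative in the normed algebra of
matrices. Differentiability comes for free, as a continuous one-parameter group is differentiable.
-/
lemma hasDerivAt_mat_exp (X : su N) :
    HasDerivAt (fun t : ℝ => R.mat (su.exp X t)) (R.deriv X) 0 := by
  have : CompleteSpace (Matrix (Fin R.dim) (Fin R.dim) ℂ) := FiniteDimensional.complete ℝ _
  have h := (differentiable_of_oneParam (A := Matrix (Fin R.dim) (Fin R.dim) ℂ)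
    (φ := fun t => R.mat (su.exp X t)) (R.continuous_mat.comp (su.continuous_exp X))
    (by rw [su.exp_zero, map_one]) (fun s t => by rw [su.exp_add, map_mul]) 0).hasDerivAt
  suffices hd : R.deriv X = _root_.deriv (fun t : ℝ => R.mat (su.exp X t)) 0 by
    rw [hd]
    exact h
  refine Matrix.ext fun i j => ?_
  let ev : Matrix (Fin R.dim) (Fin R.dim) ℂ →ₗ[ℝ] ℂ :=
    { toFun := fun M => M i j
      map_add' := fun _ _ => rfl
      map_smul' := fun _ _ => rfl }
  exact ((LinearMap.toContinuousLinearMap ev).hasFDerivAt.comp_hasDerivAt (0 : ℝ) h).deriv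

lemma deriv_smul (c : ℝ) (X : su N) : R.deriv (c • X) = c • R.deriv X := by
  have h1 : HasDerivAt (fun t : ℝ => c * t) c 0 := by
    simpa using (hasDerivAt_id (0 : ℝ)).const_mul c
  have h2 : HasDerivAt (fun t : ℝ => R.mat (su.exp X (c * t))) (c • R.deriv X) 0 :=
    HasDerivAt.scomp_of_eq (0 : ℝ) (R.hasDerivAt_mat_exp X) h1 (by simp)
  have h3 := R.hasDerivAt_mat_exp (c • X)
  simp only [su.exp_smul] at h3
  exact h3.unique h2

/-- Continuity of `R` carries the Lie product formula for `X + Y` to the matrices `R.mat`. There the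
same powers converge to the exponential of `t (dR X + dR Y)`, and uniqueness of limits identifies
the two one-parameter groups, hence their velocities. -/
lemma deriv_add (X Y : su N) : R.deriv (X + Y) = R.deriv X + R.deriv Y := by
  have : CompleteSpace (Matrix (Fin R.dim) (Fin R.dim) ℂ) := FiniteDimensional.complete ℝ _
  have key : ∀ t : ℝ, R.mat (su.exp (X + Y) t) =
      NormedSpace.exp (t • (R.deriv X + R.deriv Y)) := by
    intro t
    have h1 := (R.continuous_mat.tendsto _).comp (su.tendsto_exp_mul_exp_pow X Y t)
    have hs : HasDerivAt (fun s : ℝ => t * s) t 0 := by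
      simpa using (hasDerivAt_id (0 : ℝ)).const_mul t
    have hX : HasDerivAt (fun s : ℝ => R.mat (su.exp X (t * s))) (t • R.deriv X) 0 :=
      HasDerivAt.scomp_of_eq (0 : ℝ) (R.hasDerivAt_mat_exp X) hs (by simp)
    have hY : HasDerivAt (fun s : ℝ => R.mat (su.exp Y (t * s))) (t • R.deriv Y) 0 :=
      HasDerivAt.scomp_of_eq (0 : ℝ) (R.hasDerivAt_mat_exp Y) hs (by simp)
    have h2 := tendsto_pow_exp_of_hasDerivAt (norm_one_matrix_le R.dim)
      (by simp [su.exp_zero]) (hX.mul hY)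
    have h3 : t • R.deriv X * R.mat (su.exp Y (t * 0)) +
        R.mat (su.exp X (t * 0)) * t • R.deriv Y = t • (R.deriv X + R.deriv Y) := by
      simp [su.exp_zero]
    rw [h3] at h2
    refine tendsto_nhds_unique h1 (h2.congr fun n => ?_)
    simp
  have h4 := R.hasDerivAt_mat_exp (X + Y)
  simp only [key] at h4
  refine h4.unique ?_
  have h5 := hasDerivAt_exp_smul_const (R.deriv X + R.deriv Y) (0 : ℝ)
  rw [zero_smul, NormedSpace.exp_zero, one_mul] at h5
  exact h5

/-- The derived representation as a linear map. -/
def derivLin : su N →ₗ[ℝ] Matrix (Fin R.dim) (Fin R.dim) ℂ where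
  toFun := R.deriv
  map_add' := R.deriv_add
  map_smul' := R.deriv_smul

/-- A representation precomposed with an inner automorphism. -/
def innerTwist (U : SU N) : MatRep (SU N) where
  dim := R.dim
  mat := R.mat.comp (MulAut.conj U).toMonoidHom
  continuous_mat := R.continuous_mat.comp (by
    change Continuous fun V : SU N => U * V * U⁻¹
    fun_prop)

/-- The representation twisted by the inner automorphism of `U` is also `R` conjugated by `R.mat U`.
Differentiating both descriptions gives the equivariance of `R.deriv`. -/
lemma deriv_ad (U : SU N) (X : su N) :
    R.deriv (su.ad U X) = R.mat U * R.deriv X * R.mat U⁻¹ := by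
  have h : (R.innerTwist U).deriv X = R.mat U * R.deriv X * R.mat U⁻¹ :=
    deriv_conj (R := R) (S := R.innerTwist U) (fun V => by
      change R.mat (U * V * U⁻¹) = _
      rw [map_mul, map_mul]
      rfl) X
  rw [← h]
  ext i j
  change _root_.deriv (fun t : ℝ => R.mat (su.exp (su.ad U X) t) i j) 0 =
    _root_.deriv (fun t : ℝ => R.mat (U * su.exp X t * U⁻¹) i j) 0
  simp only [su.exp_ad]

lemma mat_inv_mul (U : SU N) : R.mat U⁻¹ * R.mat U = 1 := by
  rw [← map_mul, inv_mul_cancel, map_one]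

/-- The Casimir operator commutes with the representation. -/
lemma casimir_comm (U : SU N) : R.casimir * R.mat U = R.mat U * R.casimir := by
  let β : su N →ₗ[ℝ] su N →ₗ[ℝ] Matrix (Fin R.dim) (Fin R.dim) ℂ :=
    (LinearMap.mul ℝ (Matrix (Fin R.dim) (Fin R.dim) ℂ)).compl₁₂ R.derivLin R.derivLin
  -- Conjugation by `R.mat U` replaces both bases by their images under `su.ad U`, which is an
  -- isometry, so the sum is unchanged.
  have h := sum_dualBasis_isometry su.form_nondegenerate
    (Module.finBasis ℝ (su N)) β (su.ad U) (su.form_ad U)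
  have h2 : ∑ i, R.deriv (su.ad U (Module.finBasis ℝ (su N) i)) *
      R.deriv (su.ad U ((su.form N).dualBasis su.form_nondegenerate
        (Module.finBasis ℝ (su N)) i)) = R.casimir := h
  have h3 : R.mat U * R.casimir * R.mat U⁻¹ = R.casimir := by
    conv_rhs => rw [← h2]
    simp only [casimir, deriv_ad, Matrix.mul_sum, Matrix.sum_mul]
    refine Finset.sum_congr rfl fun i _ => ?_
    simp only [Matrix.mul_assoc]
    rw [← Matrix.mul_assoc (R.mat U⁻¹) (R.mat U), mat_inv_mul, Matrix.one_mul]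
  conv_lhs => rw [← h3]
  rw [Matrix.mul_assoc, mat_inv_mul, Matrix.mul_one]

end MatRep

end OneParameterSubgroups

/-! ## Entrywise integrals of matrix-valued functions -/

section MatrixIntegral

variable {X : Type*} [TopologicalSpace X] [CompactSpace X] [MeasurableSpace X]
  [OpensMeasurableSpace X] {l m n : Type*} [Fintype l] [Fintype m] [Fintype n]

lemma integrable_of_continuous (μ : Measure X) [IsFiniteMeasure μ] {f : X → ℂ}
    (hf : Continuous f) : Integrable f μ :=
  hf.integrable_of_hasCompactSupport (HasCompactSupport.of_compactSpace _)

/-- The entrywise integral of a matrix-valued function. -/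
def matIntegral (μ : Measure X) (F : X → Matrix m n ℂ) : Matrix m n ℂ :=
  Matrix.of fun i j => ∫ x, F x i j ∂μ

lemma mul_matIntegral (μ : Measure X) [IsFiniteMeasure μ] (C : Matrix l m ℂ)
    {F : X → Matrix m n ℂ} (hF : Continuous F) :
    C * matIntegral μ F = matIntegral μ fun x => C * F x := by
  ext i j
  simp only [matIntegral, Matrix.mul_apply, Matrix.of_apply]
  rw [integral_finsetSum (f := fun k x => C i k * F x k j) _ fun k _ =>
    integrable_of_continuous μ (continuous_const.mul (hF.matrix_elem k j))]
  simp only [integral_const_mul]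

lemma matIntegral_mul (μ : Measure X) [IsFiniteMeasure μ] (C : Matrix n l ℂ)
    {F : X → Matrix m n ℂ} (hF : Continuous F) :
    matIntegral μ F * C = matIntegral μ fun x => F x * C := by
  ext i j
  simp only [matIntegral, Matrix.mul_apply, Matrix.of_apply]
  rw [integral_finsetSum (f := fun k x => F x i k * C k j) _ fun k _ =>
    integrable_of_continuous μ ((hF.matrix_elem i k).mul continuous_const)]
  simp only [integral_mul_const]

lemma trace_matIntegral (μ : Measure X) [IsFiniteMeasure μ] {F : X → Matrix m m ℂ}
    (hF : Continuous F) : (matIntegral μ F).trace = ∫ x, (F x).trace ∂μ := by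
  simp only [Matrix.trace, Matrix.diag_apply, matIntegral, Matrix.of_apply]
  rw [integral_finsetSum _ fun k _ => integrable_of_continuous μ (hF.matrix_elem k k)]

lemma matIntegral_const (μ : Measure X) [IsProbabilityMeasure μ] (C : Matrix m n ℂ) :
    (matIntegral μ fun _ => C) = C := by
  ext i j
  simp [matIntegral]

lemma matIntegral_mul_left_eq_self {G : Type*} [Group G] [MeasurableSpace G] [MeasurableMul G]
    (μ : Measure G) [μ.IsMulLeftInvariant] (F : G → Matrix m n ℂ) (h : G) :
    (matIntegral μ fun g => F (h * g)) = matIntegral μ F := by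
  ext i j
  exact integral_mul_left_eq_self (fun g => F g i j) h

end MatrixIntegral

namespace MatRep

/-! ## Schur's lemma and complete reducibility -/

section Schur

variable {G : Type} [Group G] [TopologicalSpace G] (R S : MatRep G)

lemma mat_mul_inv (g : G) : R.mat g * R.mat g⁻¹ = 1 := by
  rw [← map_mul, mul_inv_cancel, map_one]

/-- Irreducibility includes that the lattice of subrepresentations is nontrivial, which fails in
dimension zero. -/
lemma dim_pos {R : MatRep G} (hR : R.IsIrreducible) : 0 < R.dim := by
  rcases Nat.eq_zero_or_pos R.dim with h | h
  · exfalso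
    have : Subsingleton (Fin R.dim → ℂ) := by
      rw [h]; infer_instance
    have hR' : R.toRep.IsIrreducible := hR
    obtain ⟨W, W', hW⟩ := hR'.toNontrivial
    exact hW (Subrepresentation.toSubmodule_injective (Subsingleton.elim _ _))
  · exact h

variable {R S}

/-- The linear map of a matrix that intertwines two representations. -/
def intertwiner {M : Matrix (Fin R.dim) (Fin S.dim) ℂ} (hM : ∀ g, R.mat g * M = M * S.mat g) :
    Representation.IntertwiningMap S.toRep R.toRep where
  __ := Matrix.toLin' M
  isIntertwining' g := by
    change Matrix.toLin' M ∘ₗ Matrix.toLin' (S.mat g) = Matrix.toLin' (R.mat g) ∘ₗ Matrix.toLin' M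
    rw [← Matrix.toLin'_mul, ← Matrix.toLin'_mul, hM]

lemma eq_zero_of_not_iso (hR : R.IsIrreducible) (hS : S.IsIrreducible) (h : ¬ S.Iso R)
    {M : Matrix (Fin R.dim) (Fin S.dim) ℂ} (hM : ∀ g, R.mat g * M = M * S.mat g) : M = 0 := by
  have hR' : R.toRep.IsIrreducible := hR
  have hS' : S.toRep.IsIrreducible := hS
  rcases Representation.IsIrreducible.bijective_or_eq_zero (intertwiner hM) with hb | h0
  · exact absurd ⟨(intertwiner hM).ofBijective hb⟩ h
  · have h1 : Matrix.toLin' M = 0 := congrArg Representation.IntertwiningMap.toLinearMap h0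
    simpa using h1

lemma exists_eq_smul_one (hR : R.IsIrreducible) {M : Matrix (Fin R.dim) (Fin R.dim) ℂ}
    (hM : ∀ g, R.mat g * M = M * R.mat g) : ∃ c : ℂ, M = c • 1 := by
  have hR' : R.toRep.IsIrreducible := hR
  obtain ⟨c, hc⟩ :=
    Representation.IsIrreducible.algebraMap_intertwiningMap_bijective_of_isAlgClosed.2
      (intertwiner hM)
  refine ⟨c, ?_⟩
  have h1 : Matrix.toLin' M = c • LinearMap.id :=
    (congrArg Representation.IntertwiningMap.toLinearMap hc).symm
  have h2 := congrArg LinearMap.toMatrix' h1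
  rw [LinearMap.toMatrix'_toLin', map_smul, LinearMap.toMatrix'_id] at h2
  exact h2

/-- The scalar in Schur's lemma is recovered from the trace; averages and Casimir operators are
evaluated this way. -/
lemma eq_trace_div_smul_one (hR : R.IsIrreducible) {M : Matrix (Fin R.dim) (Fin R.dim) ℂ}
    (hM : ∀ g, R.mat g * M = M * R.mat g) : M = (M.trace / R.dim) • 1 := by
  obtain ⟨c, rfl⟩ := exists_eq_smul_one hR hM
  have hd : (R.dim : ℂ) ≠ 0 := Nat.cast_ne_zero.mpr (dim_pos hR).ne'
  congr 1
  rw [Matrix.trace_smul, Matrix.trace_one, Fintype.card_fin, smul_eq_mul, mul_div_assoc,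
    div_self hd, mul_one]

/-- An idempotent matrix factors through its range. -/
lemma exists_factorization_of_idempotent {n : ℕ} {E : Matrix (Fin n) (Fin n) ℂ} (hE : E * E = E) :
    ∃ (k : ℕ) (A : Matrix (Fin n) (Fin k) ℂ) (B : Matrix (Fin k) (Fin n) ℂ),
      A * B = E ∧ B * A = 1 := by
  set e := Matrix.toLin' E with he
  have hee : ∀ v, e (e v) = e v := fun v => by
    rw [← LinearMap.comp_apply, he, ← Matrix.toLin'_mul, hE]
  let b := Module.finBasis ℂ (LinearMap.range e)
  refine ⟨Module.finrank ℂ (LinearMap.range e),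
    LinearMap.toMatrix' ((LinearMap.range e).subtype ∘ₗ b.equivFun.symm.toLinearMap),
    LinearMap.toMatrix' (b.equivFun.toLinearMap ∘ₗ e.rangeRestrict), ?_, ?_⟩
  · rw [← LinearMap.toMatrix'_comp, ← LinearMap.toMatrix'_toLin' E, ← he]
    congr 1
    refine LinearMap.ext fun v => ?_
    simp
  · rw [← LinearMap.toMatrix'_comp, ← LinearMap.toMatrix'_id]
    congr 1
    refine LinearMap.ext fun v => ?_
    -- An idempotent is the identity on its range.
    have h : e.rangeRestrict (b.equivFun.symm v : Fin n → ℂ) = b.equivFun.symm v := by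
      obtain ⟨w, hw⟩ := (b.equivFun.symm v).2
      refine Subtype.ext ?_
      rw [LinearMap.codRestrict_apply, ← hw, hee]
    simp only [LinearMap.comp_apply, LinearEquiv.coe_coe, Submodule.subtype_apply, h,
      LinearEquiv.apply_symm_apply, LinearMap.id_apply]

lemma Iso.dim_eq (h : R.Iso S) : R.dim = S.dim := by
  obtain ⟨e⟩ := h
  simpa using e.toLinearEquiv.finrank_eq

/-- The representation on the range of an equivariant idempotent `A * B`. -/
def compress (R : MatRep G) {k : ℕ} {A : Matrix (Fin R.dim) (Fin k) ℂ}
    {B : Matrix (Fin k) (Fin R.dim) ℂ} (hBA : B * A = 1)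
    (hc : ∀ g, A * B * R.mat g = R.mat g * (A * B)) : MatRep G where
  dim := k
  mat :=
    { toFun := fun g => B * R.mat g * A
      map_one' := by rw [map_one, Matrix.mul_one, hBA]
      map_mul' := fun g h => by
        have h1 : B * R.mat g * A * (B * R.mat h * A) = B * (R.mat g * (A * B)) * R.mat h * A := by
          simp only [Matrix.mul_assoc]
        rw [h1, ← hc, map_mul]
        simp only [← Matrix.mul_assoc, hBA, Matrix.one_mul] }
  continuous_mat := (continuous_const.matrix_mul R.continuous_mat).matrix_mul continuous_const

/-- An equivariant idempotent splits a representation. -/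
lemma exists_iso_sum_of_idempotent (R : MatRep G) {E : Matrix (Fin R.dim) (Fin R.dim) ℂ}
    (hE : E * E = E) (hc : ∀ g, E * R.mat g = R.mat g * E) (h0 : E ≠ 0) (h1 : E ≠ 1) :
    ∃ S T : MatRep G, R.Iso (S.sum T) ∧ S.dim < R.dim ∧ T.dim < R.dim := by
  obtain ⟨k, A, B, hAB, hBA⟩ := exists_factorization_of_idempotent hE
  obtain ⟨k', A', B', hAB', hBA'⟩ := exists_factorization_of_idempotent
    (show (1 - E) * (1 - E) = 1 - E by simp [mul_sub, sub_mul, hE])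
  have hcS : ∀ g, A * B * R.mat g = R.mat g * (A * B) := fun g => by rw [hAB, hc]
  have hcT : ∀ g, A' * B' * R.mat g = R.mat g * (A' * B') := fun g => by
    rw [hAB', sub_mul, mul_sub, hc, one_mul, mul_one]
  have hBE : B * E = B := by rw [← hAB, ← Matrix.mul_assoc, hBA, Matrix.one_mul]
  have hBE' : B' * E = 0 := by
    have : B' * (1 - E) = B' := by rw [← hAB', ← Matrix.mul_assoc, hBA', Matrix.one_mul]
    rw [Matrix.mul_sub, Matrix.mul_one] at this
    simpa using this
  have hEA : E * A = A := by rw [← hAB, Matrix.mul_assoc, hBA, Matrix.mul_one]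
  have hEA' : E * A' = 0 := by
    have : (1 - E) * A' = A' := by rw [← hAB', Matrix.mul_assoc, hBA', Matrix.mul_one]
    rw [Matrix.sub_mul, Matrix.one_mul] at this
    simpa using this
  -- The change of basis stacks the coordinates on the ranges of `E` and `1 - E`; its inverse puts
  -- the two inclusions side by side.
  have hsim : Sim R.mat (fun g => fromBlocks ((R.compress hBA hcS).mat g) 0 0
      ((R.compress hBA' hcT).mat g)) := by
    refine ⟨fromRows B B', fromCols A A', ?_, ?_, fun g => ?_⟩
    · change fromRows B B' * fromCols A A' = (1 : Matrix (Fin k ⊕ Fin k') (Fin k ⊕ Fin k') ℂ)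
      rw [fromRows_mul_fromCols, hBA, hBA']
      have z1 : B * A' = 0 := by rw [← hBE, Matrix.mul_assoc, hEA', Matrix.mul_zero]
      have z2 : B' * A = 0 := by rw [← hEA, ← Matrix.mul_assoc, hBE', Matrix.zero_mul]
      rw [z1, z2]
      exact fromBlocks_one
    · refine (fromCols_mul_fromRows A A' B B').trans ?_
      rw [ hAB, hAB']
      abel
    · have e1 : B * R.mat g * A * B = B * R.mat g := by
        rw [Matrix.mul_assoc, Matrix.mul_assoc, ← hcS, ← Matrix.mul_assoc, ← Matrix.mul_assoc,
          hBA, Matrix.one_mul]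
      have e2 : B' * R.mat g * A' * B' = B' * R.mat g := by
        rw [Matrix.mul_assoc, Matrix.mul_assoc, ← hcT, ← Matrix.mul_assoc, ← Matrix.mul_assoc,
          hBA', Matrix.one_mul]
      change fromRows B B' * R.mat g =
        fromBlocks (B * R.mat g * A) 0 0 (B' * R.mat g * A') * fromRows B B'
      rw [fromRows_mul, fromBlocks_mul_fromRows, e1, e2]
      simp
  have hiso : R.Iso ((R.compress hBA hcS).sum (R.compress hBA' hcT)) :=
    iso_iff_sim.mpr (hsim.trans (sim_sum _ _))
  have hdim : R.dim = k + k' := hiso.dim_eq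
  -- `E ≠ 0` and `E ≠ 1` make both summands nonzero, so each has dimension strictly below that of
  -- `R`; the induction on dimension needs this.
  have hk : 0 < k := by
    rcases Nat.eq_zero_or_pos k with rfl | h
    · exact absurd (hAB.symm.trans (by ext i j; simp [Matrix.mul_apply])) h0
    · exact h
  have hk' : 0 < k' := by
    rcases Nat.eq_zero_or_pos k' with rfl | h
    · have : 1 - E = 0 := hAB'.symm.trans (by ext i j; simp [Matrix.mul_apply])
      exact absurd (sub_eq_zero.mp this).symm h1
    · exact h
  exact ⟨_, _, hiso, by change k < R.dim; omega, by change k' < R.dim; omega⟩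

variable (R) in
lemma continuous_char : Continuous R.char :=
  R.continuous_mat.matrix_trace

lemma char_iso (h : R.Iso S) : R.char = S.char := by
  obtain ⟨P, Q, h1, h2, h3⟩ := iso_iff_sim.mp h
  funext g
  rw [char, char, Sim.eq_conj h1 (h3 g), Matrix.trace_mul_comm, ← Matrix.mul_assoc, h2,
    Matrix.one_mul]

lemma char_conj (R : MatRep G) (g : G) : R.conj.char g = (starRingEnd ℂ) (R.char g) := by
  simp only [char, Matrix.trace, Matrix.diag_apply, map_sum]
  rfl

end Schur

/-! ### Averages over the group and Schur orthogonality. -/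

section Averaging

variable {G : Type} [Group G] [TopologicalSpace G] [IsTopologicalGroup G] [CompactSpace G]
  [MeasurableSpace G] [BorelSpace G] (μ : Measure G) [IsProbabilityMeasure μ]
  [μ.IsMulLeftInvariant]

/-- The average of a matrix over the group. -/
def average (R S : MatRep G) (M : Matrix (Fin R.dim) (Fin S.dim) ℂ) :
    Matrix (Fin R.dim) (Fin S.dim) ℂ :=
  matIntegral μ fun g => R.mat g * M * S.mat g⁻¹

lemma continuous_average_integrand (R S : MatRep G) (M : Matrix (Fin R.dim) (Fin S.dim) ℂ) :
    Continuous fun g => R.mat g * M * S.mat g⁻¹ :=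
  (R.continuous_mat.matrix_mul continuous_const).matrix_mul (S.continuous_mat.comp continuous_inv)

/-- Left invariance of the measure absorbs the factor `R.mat h`. Thus averages are intertwiners, to
which Schur's lemma applies. -/
lemma mat_mul_average (R S : MatRep G) (M : Matrix (Fin R.dim) (Fin S.dim) ℂ) (h : G) :
    R.mat h * average μ R S M = average μ R S M * S.mat h := by
  unfold average
  rw [mul_matIntegral μ _ (continuous_average_integrand R S M),
    matIntegral_mul μ _ (continuous_average_integrand R S M),
    ← matIntegral_mul_left_eq_self μ (fun g => R.mat g * M * S.mat g⁻¹ * S.mat h) h]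
  congr 1
  funext g
  rw [Matrix.mul_assoc _ (S.mat _) (S.mat h), ← map_mul S.mat]
  simp [Matrix.mul_assoc]

/-- Averaging a matrix unit isolates a single integral of products of matrix entries. -/
lemma average_single_apply (R S : MatRep G) (k i : Fin R.dim) (l j : Fin S.dim) :
    average μ R S (Matrix.single k l 1) i j = ∫ g, R.mat g i k * S.mat g⁻¹ l j ∂μ := by
  simp only [average, matIntegral, Matrix.of_apply]
  congr 1
  funext g
  simp [Matrix.mul_apply, Matrix.single_apply, ite_and, Finset.sum_ite_eq]

/-- Orthogonality of the matrix entries of inequivalent irreducible representations. -/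
lemma integral_mat_mul_mat_inv_of_not_iso {R S : MatRep G} (hR : R.IsIrreducible)
    (hS : S.IsIrreducible) (h : ¬ S.Iso R) (i k : Fin R.dim) (l j : Fin S.dim) :
    ∫ g, R.mat g i k * S.mat g⁻¹ l j ∂μ = 0 := by
  rw [← average_single_apply, eq_zero_of_not_iso hR hS h (mat_mul_average μ R S _)]
  rfl

/-- Orthogonality of the matrix entries of an irreducible representation. -/
lemma integral_mat_mul_mat_inv {R : MatRep G} (hR : R.IsIrreducible) (i k l j : Fin R.dim) :
    ∫ g, R.mat g i k * R.mat g⁻¹ l j ∂μ = if i = j ∧ k = l then (R.dim : ℂ)⁻¹ else 0 := by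
  -- Conjugation preserves the trace, so the average has the trace of the matrix unit; this fixes
  -- the Schur scalar.
  have htr : (average μ R R (Matrix.single k l 1)).trace = if k = l then 1 else 0 := by
    rw [average, trace_matIntegral μ (continuous_average_integrand R R _)]
    have : ∀ g, (R.mat g * Matrix.single k l 1 * R.mat g⁻¹).trace = if k = l then 1 else 0 := by
      intro g
      rw [Matrix.trace_mul_comm, ← Matrix.mul_assoc, ← map_mul, inv_mul_cancel, map_one,
        Matrix.one_mul]
      by_cases hkl : k = l
      · subst hkl; simp
      · simp [hkl, Matrix.trace_single_eq_of_ne]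
    simp [this]
  rw [← average_single_apply, eq_trace_div_smul_one hR (mat_mul_average μ R R _), htr]
  by_cases hij : i = j <;> by_cases hkl : k = l <;> simp [hij, hkl]

/-- Orthogonality is phrased with `g⁻¹` instead of complex conjugation, so that no invariant inner
product is needed here. -/
lemma integral_char_mul_char_inv_eq_sum (R S : MatRep G) :
    ∫ g, R.char g * S.char g⁻¹ ∂μ = ∑ i, ∑ j, ∫ g, R.mat g i i * S.mat g⁻¹ j j ∂μ := by
  have hc : ∀ i j, Integrable (fun g => R.mat g i i * S.mat g⁻¹ j j) μ := fun i j =>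
    integrable_of_continuous μ ((R.continuous_mat.matrix_elem i i).mul
      ((S.continuous_mat.comp continuous_inv).matrix_elem j j))
  simp only [char, Matrix.trace, Matrix.diag_apply, Finset.sum_mul_sum]
  rw [integral_finsetSum _ fun i _ => integrable_finsetSum _ fun j _ => hc i j]
  exact Finset.sum_congr rfl fun i _ => integral_finsetSum _ fun j _ => hc i j

lemma integral_char_mul_char_inv_of_not_iso {R S : MatRep G} (hR : R.IsIrreducible)
    (hS : S.IsIrreducible) (h : ¬ S.Iso R) : ∫ g, R.char g * S.char g⁻¹ ∂μ = 0 := by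
  rw [integral_char_mul_char_inv_eq_sum]
  simp [integral_mat_mul_mat_inv_of_not_iso μ hR hS h]

lemma integral_char_mul_char_inv_self {R : MatRep G} (hR : R.IsIrreducible) :
    ∫ g, R.char g * R.char g⁻¹ ∂μ = 1 := by
  have hd : (R.dim : ℂ) ≠ 0 := Nat.cast_ne_zero.mpr (dim_pos hR).ne'
  rw [integral_char_mul_char_inv_eq_sum]
  simp [integral_mat_mul_mat_inv μ hR, hd]

end Averaging

/-! ### Complete reducibility, conjugates and invariant Hermitian forms. -/

section Compact

variable {G : Type} [Group G] [TopologicalSpace G] [IsTopologicalGroup G] [CompactSpace G]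

/-- A nonzero representation without equivariant idempotents is irreducible. -/
lemma exists_idempotent_of_not_irreducible {R : MatRep G} (hd : 0 < R.dim)
    (hR : ¬ R.IsIrreducible) : ∃ E : Matrix (Fin R.dim) (Fin R.dim) ℂ,
      E * E = E ∧ (∀ g, E * R.mat g = R.mat g * E) ∧ E ≠ 0 ∧ E ≠ 1 := by
  let _ : MeasurableSpace G := borel G
  have : BorelSpace G := ⟨rfl⟩
  let μ : Measure G := Measure.haarMeasure ⊤
  have : IsProbabilityMeasure μ := ⟨Measure.haarMeasure_self (K₀ := ⊤)⟩
  have hnt : Nontrivial (Subrepresentation R.toRep) := by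
    have : Nonempty (Fin R.dim) := ⟨⟨0, hd⟩⟩
    refine ⟨⊥, ⊤, fun h => ?_⟩
    have h2 : (⊥ : Submodule ℂ (Fin R.dim → ℂ)) = ⊤ :=
      congrArg Subrepresentation.toSubmodule h
    exact bot_ne_top h2
  obtain ⟨W, hbot, htop⟩ : ∃ W : Subrepresentation R.toRep, W ≠ ⊥ ∧ W ≠ ⊤ := by
    by_contra! hcon
    exact hR ⟨fun W => or_iff_not_imp_left.mpr (hcon W)⟩
  -- A linear projection `P` onto the invariant subspace, not yet equivariant; averaging will make
  -- it so.
  obtain ⟨q, hq⟩ := LinearMap.exists_leftInverse_of_injective W.toSubmodule.subtype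
    (Submodule.ker_subtype _)
  set e : (Fin R.dim → ℂ) →ₗ[ℂ] (Fin R.dim → ℂ) := W.toSubmodule.subtype ∘ₗ q with he
  have hmem : ∀ v, e v ∈ W.toSubmodule := fun v => (q v).2
  have hfix : ∀ w ∈ W.toSubmodule, e w = w := fun w hw =>
    congrArg Subtype.val (LinearMap.congr_fun hq ⟨w, hw⟩)
  set P := LinearMap.toMatrix' e with hP
  have hinv : ∀ g, P * (R.mat g * P) = R.mat g * P := by
    intro g
    have hRg : R.mat g = LinearMap.toMatrix' (R.toRep g) := (LinearMap.toMatrix'_toLin' _).symm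
    rw [hRg, hP, ← LinearMap.toMatrix'_comp, ← LinearMap.toMatrix'_comp]
    congr 1
    exact LinearMap.ext fun v => hfix _ (W.apply_mem_toSubmodule g (hmem v))
  -- `P * E = E` holds as `W` is invariant, and `E * P = P` as every conjugate of `P` by the group
  -- fixes `W` pointwise. So `E` is idempotent with the same range as `P`.
  set E := average μ R R P with hE
  have hPE : P * E = E := by
    rw [hE, average, mul_matIntegral μ _ (continuous_average_integrand R R _)]
    congr 1
    funext g
    rw [← Matrix.mul_assoc, hinv]
  have hEP : E * P = P := by
    rw [hE, average, matIntegral_mul μ _ (continuous_average_integrand R R _)]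
    have : ∀ g, R.mat g * P * R.mat g⁻¹ * P = P := fun g => by
      rw [Matrix.mul_assoc, Matrix.mul_assoc, hinv, ← Matrix.mul_assoc, mat_mul_inv,
        Matrix.one_mul]
    simp only [this, matIntegral_const]
  refine ⟨E, ?_, fun g => (mat_mul_average μ R R P g).symm, fun h0 => hbot ?_, fun h1 => htop ?_⟩
  · calc E * E = E * P * E := by rw [Matrix.mul_assoc, hPE]
      _ = E := by rw [hEP, hPE]
  · have hP0 : e = 0 := by
      rw [h0, Matrix.zero_mul] at hEP
      exact LinearMap.toMatrix'.injective (hEP.symm.trans (map_zero _).symm)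
    refine Subrepresentation.toSubmodule_injective ((Submodule.eq_bot_iff _).mpr fun w hw => ?_)
    rw [← hfix w hw, hP0, LinearMap.zero_apply]
  · have hP1 : e = LinearMap.id := by
      rw [h1, Matrix.mul_one] at hPE
      exact LinearMap.toMatrix'.injective (hPE.trans LinearMap.toMatrix'_id.symm)
    refine Subrepresentation.toSubmodule_injective (eq_top_iff.mpr fun v _ => ?_)
    have := hmem v
    rwa [hP1] at this

/-- A nonzero representation whose commutant consists of scalars is irreducible. -/
lemma isIrreducible_of_commutant {R : MatRep G} (hd : 0 < R.dim)
    (hc : ∀ M : Matrix (Fin R.dim) (Fin R.dim) ℂ, (∀ g, R.mat g * M = M * R.mat g) →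
      ∃ c : ℂ, M = c • 1) : R.IsIrreducible := by
  by_contra hR
  obtain ⟨E, hE, hcomm, h0, h1⟩ := exists_idempotent_of_not_irreducible hd hR
  obtain ⟨c, rfl⟩ := hc E fun g => (hcomm g).symm
  -- A scalar idempotent is `0` or `1`, both of which are excluded for `E`.
  have hcc : c * c = c := by
    have h := congrFun (congrFun hE ⟨0, hd⟩) ⟨0, hd⟩
    simpa using h
  rcases eq_or_ne c 0 with rfl | hc0
  · exact h0 (zero_smul _ _)
  · rw [mul_eq_left₀ hc0] at hcc
    exact h1 (by rw [hcc, one_smul])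

/-- Entrywise conjugation carries the commutant of `R.conj` to that of `R`, so it too consists of
scalars. -/
lemma IsIrreducible.conj {R : MatRep G} (hR : R.IsIrreducible) : R.conj.IsIrreducible := by
  have hd : 0 < R.dim := dim_pos hR
  refine isIrreducible_of_commutant (R := R.conj) hd
    fun (M : Matrix (Fin R.dim) (Fin R.dim) ℂ) hM => ?_
  let σ := (starRingEnd ℂ).mapMatrix (m := Fin R.dim)
  have hσ : ∀ A : Matrix (Fin R.dim) (Fin R.dim) ℂ, σ (σ A) = A := fun A => by
    ext i j
    exact Complex.conj_conj _
  have hM' : ∀ g, σ (R.mat g) * M = M * σ (R.mat g) := hM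
  have h1 : ∀ g, R.mat g * σ M = σ M * R.mat g := by
    intro g
    have h := congrArg σ (hM' g)
    rwa [map_mul, map_mul, hσ] at h
  obtain ⟨c, hc⟩ := exists_eq_smul_one hR h1
  refine ⟨(starRingEnd ℂ) c, ?_⟩
  have h3 : M = σ (c • 1) := by rw [← hc, hσ]
  refine h3.trans (Matrix.ext fun i j => ?_)
  change (starRingEnd ℂ) (c * (1 : Matrix (Fin R.dim) (Fin R.dim) ℂ) i j) =
    (starRingEnd ℂ) c * (1 : Matrix (Fin R.dim) (Fin R.dim) ℂ) i j
  by_cases hij : i = j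
  · subst hij; simp
  · simp [hij]

/-- Every representation carries an invariant nondegenerate Hermitian form. -/
lemma exists_invariant_form (R : MatRep G) :
    ∃ H K : Matrix (Fin R.dim) (Fin R.dim) ℂ, H * K = 1 ∧ K * H = 1 ∧
      ∀ g, (R.mat g)ᴴ * H = H * R.mat g⁻¹ := by
  let _ : MeasurableSpace G := borel G
  have : BorelSpace G := ⟨rfl⟩
  let μ : Measure G := Measure.haarMeasure ⊤
  have : IsProbabilityMeasure μ := ⟨Measure.haarMeasure_self (K₀ := ⊤)⟩
  have hc : Continuous fun g => R.mat g⁻¹ := R.continuous_mat.comp continuous_inv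
  have hcH : Continuous fun g => (R.mat g⁻¹)ᴴ * R.mat g⁻¹ :=
    hc.matrix_conjTranspose.matrix_mul hc
  -- Weyl's unitary trick. With `g⁻¹` in the integrand, left invariance of the measure yields the
  -- invariance of `H`.
  set H := matIntegral μ fun g => (R.mat g⁻¹)ᴴ * R.mat g⁻¹ with hH
  have hunit : IsUnit H := by
    rw [← Matrix.mulVec_injective_iff_isUnit]
    -- If `H v = 0`, then `vᴴ H v` is the integral of the squared lengths of `R(g⁻¹) v` and
    -- vanishes. The integrand is continuous and nonnegative, hence zero everywhere, and `g = 1`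
    -- gives `v = 0`.
    refine (injective_iff_map_eq_zero H.mulVecLin).mpr fun v hv => ?_
    have hv' : H *ᵥ v = 0 := hv
    let V : Matrix (Fin R.dim) Unit ℂ := replicateCol Unit v
    have hHV : H * V = 0 := by
      ext i j
      exact congrFun hv' i
    have h1 : matIntegral μ (fun g => Vᴴ * ((R.mat g⁻¹)ᴴ * R.mat g⁻¹) * V) = 0 := by
      rw [← matIntegral_mul μ V (continuous_const.matrix_mul hcH), ← mul_matIntegral μ Vᴴ hcH,
        Matrix.mul_assoc, ← hH, hHV, Matrix.mul_zero]
    have h2 := congrFun (congrFun h1 ()) ()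
    have h3 : ∀ g, (Vᴴ * ((R.mat g⁻¹)ᴴ * R.mat g⁻¹) * V) () () =
        ((∑ i, ‖(R.mat g⁻¹ *ᵥ v) i‖ ^ 2 : ℝ) : ℂ) := by
      intro g
      have : Vᴴ * ((R.mat g⁻¹)ᴴ * R.mat g⁻¹) * V = (R.mat g⁻¹ * V)ᴴ * (R.mat g⁻¹ * V) := by
        simp only [conjTranspose_mul, Matrix.mul_assoc]
      rw [this, Matrix.mul_apply]
      push_cast
      refine Finset.sum_congr rfl fun i _ => ?_
      exact Complex.conj_mul' _
    simp only [matIntegral, Matrix.of_apply, h3, Matrix.zero_apply, integral_complex_ofReal,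
      Complex.ofReal_eq_zero] at h2
    have hcont : Continuous fun g => ∑ i, ‖(R.mat g⁻¹ *ᵥ v) i‖ ^ 2 := by
      have h4 : Continuous fun g => R.mat g⁻¹ *ᵥ v := hc.matrix_mulVec continuous_const
      exact continuous_finsetSum _ fun i _ => ((continuous_apply i).comp h4).norm.pow 2
    have h5 := (integral_eq_zero_iff_of_nonneg (fun g => by positivity)
      (hcont.integrable_of_hasCompactSupport (HasCompactSupport.of_compactSpace _))).mp h2
    have h6 := congrFun ((hcont.ae_eq_iff_eq μ continuous_const).mp h5) 1
    simp only [inv_one, map_one, Matrix.one_mulVec] at h6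
    funext i
    have h7 := (Finset.sum_eq_zero_iff_of_nonneg fun i _ => by positivity).mp h6 i
      (Finset.mem_univ i)
    simpa using h7
  refine ⟨H, H⁻¹, Matrix.mul_nonsing_inv _ ((Matrix.isUnit_iff_isUnit_det _).mp hunit),
    Matrix.nonsing_inv_mul _ ((Matrix.isUnit_iff_isUnit_det _).mp hunit), fun h => ?_⟩
  rw [hH, mul_matIntegral μ _ hcH, matIntegral_mul μ _ hcH,
    ← matIntegral_mul_left_eq_self μ (fun g => (R.mat h)ᴴ * ((R.mat g⁻¹)ᴴ * R.mat g⁻¹)) h]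
  congr 1
  funext g
  rw [← Matrix.mul_assoc, ← conjTranspose_mul, ← map_mul]
  simp [Matrix.mul_assoc]

/-- The invariant form makes `R(g)ᴴ` conjugate to `R(g⁻¹)`; traces are compared. -/
lemma char_inv (R : MatRep G) (g : G) :
    R.char g⁻¹ = (starRingEnd ℂ) (R.char g) := by
  obtain ⟨H, K, hHK, hKH, h⟩ := exists_invariant_form R
  have h1 : (R.mat g)ᴴ = H * R.mat g⁻¹ * K := by
    rw [← h, Matrix.mul_assoc, hHK, Matrix.mul_one]
  have h2 := congrArg Matrix.trace h1
  rw [Matrix.trace_conjTranspose, Matrix.trace_mul_comm, ← Matrix.mul_assoc, hKH,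
    Matrix.one_mul] at h2
  exact h2.symm

end Compact

end MatRep

/-- The Grothendieck ring of a compact group is generated by the irreducible representations. -/
lemma RepRing.induction_irreducible {G : Type} [Group G] [TopologicalSpace G]
    [IsTopologicalGroup G] [CompactSpace G]
    {p : RepRing G → Prop} (h0 : p 0)
    (hadd : ∀ x y, p x → p y → p (x + y)) (hsub : ∀ x y, p x → p y → p (x - y))
    (hirr : ∀ R : MatRep G, R.IsIrreducible → p (RepRing.cls R)) (x : RepRing G) : p x := by
  -- Strong induction on the dimension: a reducible representation splits into two smaller ones, and
  -- dimension zero gives the class `0`.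
  have hcls : ∀ (n : ℕ) (R : MatRep G), R.dim = n → p (RepRing.cls R) := by
    intro n
    induction n using Nat.strong_induction_on with
    | _ n ih =>
      intro R hn
      by_cases hR : R.IsIrreducible
      · exact hirr R hR
      rcases Nat.eq_zero_or_pos R.dim with hd | hd
      · have hiso : R.Iso (MatRep.zero G) := by
          have e : Fin R.dim ≃ Fin (MatRep.zero G).dim := finCongr hd
          have : IsEmpty (Fin R.dim) := by rw [hd]; exact Fin.isEmpty
          exact MatRep.iso_iff_sim.mpr (Sim.of_reindex e fun g i => isEmptyElim i)
        have : RepRing.cls R = 0 :=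
          (congrArg RepRing.of (Quotient.sound hiso : RepClass.mk R = 0)).trans (map_zero _)
        rw [this]
        exact h0
      · obtain ⟨E, hE, hc, hE0, hE1⟩ := MatRep.exists_idempotent_of_not_irreducible hd hR
        obtain ⟨S, T, hiso, hS, hT⟩ := R.exists_iso_sum_of_idempotent hE hc hE0 hE1
        have hST : RepClass.mk R = RepClass.mk S + RepClass.mk T := Quotient.sound hiso
        have : RepRing.cls R = RepRing.cls S + RepRing.cls T := by
          rw [RepRing.cls, hST, map_add]
          rfl
        rw [this]
        exact hadd _ _ (ih _ (hn ▸ hS) S rfl) (ih _ (hn ▸ hT) T rfl)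
  obtain ⟨⟨R⟩, ⟨S⟩, rfl⟩ := RepRing.exists_sub x
  exact hsub _ _ (hcls _ R rfl) (hcls _ S rfl)

namespace MatRep

/-! ## The Casimir operator of an irreducible representation -/

section Casimir

variable {N : ℕ}

/-- The Hermitian dual `g ↦ R(g⁻¹)ᴴ` of a representation. -/
def hermDual (R : MatRep (SU N)) : MatRep (SU N) where
  dim := R.dim
  mat :=
    { toFun := fun U => (R.mat U⁻¹)ᴴ
      map_one' := by simp
      map_mul' := fun U V => by rw [_root_.mul_inv_rev, map_mul, conjTranspose_mul] }
  continuous_mat := (R.continuous_mat.comp continuous_inv).matrix_conjTranspose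

lemma deriv_hermDual (R : MatRep (SU N)) (X : su N) : R.hermDual.deriv X = -(R.deriv X)ᴴ := by
  have hinv : ∀ t, (su.exp X t)⁻¹ = su.exp (-X) t := fun t => by
    have h1 : su.exp (-X) t = su.exp X (-t) := by
      rw [← neg_one_smul ℝ X, su.exp_smul, neg_one_mul]
    rw [h1, inv_eq_iff_mul_eq_one, ← su.exp_add, add_neg_cancel, su.exp_zero]
  have hneg : R.deriv (-X) = -R.deriv X := map_neg R.derivLin X
  refine Matrix.ext fun (i j : Fin R.dim) => ?_
  change _root_.deriv (fun t : ℝ => star (R.mat (su.exp X t)⁻¹ j i)) 0 = -star (R.deriv X j i)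
  simp only [hinv]
  have h := (R.differentiableAt_mat (-X) j i 0).hasDerivAt.star.deriv
  refine h.trans ?_
  change star (R.deriv (-X) j i) = _
  rw [hneg, Matrix.neg_apply, star_neg]

/-- The two minus signs from `deriv_hermDual` cancel, and the trace undoes the reversal of order
caused by the conjugate transpose. -/
lemma trace_casimir_hermDual (R : MatRep (SU N)) :
    R.hermDual.casimir.trace = star R.casimir.trace := by
  have h : R.hermDual.casimir = ∑ i, (R.deriv ((su.form N).dualBasis su.form_nondegenerate
      (Module.finBasis ℝ (su N)) i) * R.deriv (Module.finBasis ℝ (su N) i))ᴴ := by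
    refine Finset.sum_congr rfl fun i _ => ?_
    rw [deriv_hermDual, deriv_hermDual, conjTranspose_mul]
    exact neg_mul_neg (α := Matrix (Fin R.dim) (Fin R.dim) ℂ) _ _
  refine (congrArg (fun M : Matrix (Fin R.dim) (Fin R.dim) ℂ => M.trace) h).trans ?_
  rw [casimir, Matrix.trace_sum, Matrix.trace_sum, star_sum]
  refine Finset.sum_congr rfl fun i _ => ?_
  rw [Matrix.trace_conjTranspose, Matrix.trace_mul_comm]

lemma trace_casimir_iso {R S : MatRep (SU N)} (h : R.Iso S) :
    R.casimir.trace = S.casimir.trace := by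
  obtain ⟨P, Q, h1, h2, h3⟩ := iso_iff_sim.mp h
  rw [casimir_conj h2 fun U => Sim.eq_conj h1 (h3 U), Matrix.trace_mul_comm, ← Matrix.mul_assoc,
    h2, Matrix.one_mul]

/-- The invariant Hermitian form is itself the intertwiner. -/
lemma iso_hermDual (R : MatRep (SU N)) : R.Iso R.hermDual := by
  obtain ⟨H, K, h1, h2, h⟩ := exists_invariant_form R
  refine iso_iff_sim.mpr ⟨H, K, h1, h2, fun U => ?_⟩
  have h3 := h U⁻¹
  rw [inv_inv] at h3
  exact h3.symm

/-- The Hermitian dual conjugates the trace and is isomorphic to `R`, so the trace is real. Thus the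
real part taken in `C2` loses nothing. -/
lemma trace_casimir_eq_re (R : MatRep (SU N)) : R.casimir.trace = (R.casimir.trace.re : ℂ) :=
  Complex.conj_eq_iff_re.mp
    ((trace_casimir_hermDual R).symm.trans (trace_casimir_iso R.iso_hermDual).symm) |>.symm

/-- The Casimir operator of an irreducible representation is a scalar. -/
lemma casimir_eq_smul_one {R : MatRep (SU N)} (hR : R.IsIrreducible) :
    R.casimir = (R.C2 : ℂ) • 1 := by
  have h := eq_trace_div_smul_one hR fun U => (R.casimir_comm U).symm
  rw [trace_casimir_eq_re] at h
  rw [C2, Complex.ofReal_div, Complex.ofReal_natCast]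
  exact h

lemma heat_eq_smul_one {R : MatRep (SU N)} (hR : R.IsIrreducible) (g a : ℝ) :
    R.heat g a = (Real.exp (-(g ^ 2 * a / 2) * R.C2) : ℂ) • 1 := by
  rw [heat, casimir_eq_smul_one hR, smul_smul, smul_one_eq_diagonal, Matrix.exp_diagonal,
    smul_one_eq_diagonal]
  congr 1
  funext i
  rw [Pi.coe_exp, ← Complex.exp_eq_exp_ℂ]
  push_cast
  rfl

lemma C2_iso {R S : MatRep (SU N)} (h : R.Iso S) : R.C2 = S.C2 := by
  rw [C2, C2, trace_casimir_iso h, h.dim_eq]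

lemma deriv_conj_apply (R : MatRep (SU N)) (X : su N) (i j : Fin R.dim) :
    R.conj.deriv X i j = star (R.deriv X i j) :=
  (R.differentiableAt_mat X i j 0).hasDerivAt.star.deriv

/-- The Casimir operator of `R.conj` is the entrywise conjugate, since the parameter `t` and both
bases of the real Lie algebra stay the same; real parts of traces agree. -/
lemma C2_conj (R : MatRep (SU N)) : R.conj.C2 = R.C2 := by
  have h : R.conj.casimir = (starRingEnd ℂ).mapMatrix R.casimir := by
    rw [casimir, casimir, map_sum]
    refine Finset.sum_congr rfl fun i _ => ?_
    rw [map_mul]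
    congr 1 <;> exact Matrix.ext fun i j => deriv_conj_apply R _ i j
  have h2 : R.conj.casimir.trace = (starRingEnd ℂ) R.casimir.trace := by
    refine (congrArg (fun M : Matrix (Fin R.dim) (Fin R.dim) ℂ => M.trace) h).trans ?_
    simp [Matrix.trace]
  change R.conj.casimir.trace.re / R.dim = R.casimir.trace.re / R.dim
  rw [h2, Complex.conj_re]

end Casimir

end MatRep

/-! ### Weights of the sectors. -/

section Weight

variable {N : ℕ} (g a : ℝ) (p : ℕ)

lemma weight_iso {R S : MatRep (SU N)} (h : R.Iso S) : weight g a p R = weight g a p S := by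
  rw [weight, weight, MatRep.C2_iso h, h.dim_eq]

lemma weight_conj (R : MatRep (SU N)) : weight g a p R.conj = weight g a p R := by
  rw [weight, weight, MatRep.C2_conj]
  rfl

lemma weight_pos {R : MatRep (SU N)} (hR : R.IsIrreducible) : 0 < weight g a p R := by
  have := MatRep.dim_pos hR
  unfold weight
  positivity

lemma weight_selected (d : LoopDir) (κ : MatRep (SU N)) :
    weight g a p (d.selected κ) = weight g a p κ := by
  cases d
  · exact weight_conj g a p κ
  · rfl

end Weight

lemma LoopDir.isIrreducible_selected {N : ℕ} (d : LoopDir) {κ : MatRep (SU N)}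
    (hκ : κ.IsIrreducible) : (d.selected κ).IsIrreducible := by
  cases d
  · exact hκ.conj
  · exact hκ

/-! ## Integration over the holonomies -/

/-- Fubini, entry by entry: factors that depend on independent variables are averaged separately. -/
lemma matIntegral_prod_mul {X Y : Type*} [TopologicalSpace X] [CompactSpace X]
    [MeasurableSpace X] [OpensMeasurableSpace X] [TopologicalSpace Y] [CompactSpace Y]
    [MeasurableSpace Y] [OpensMeasurableSpace Y] (μ : Measure X) [IsFiniteMeasure μ]
    (ν : Measure Y) [IsFiniteMeasure ν] {l m n : Type*} [Fintype m] {F : X → Matrix l m ℂ}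
    {K : Y → Matrix m n ℂ} (hF : Continuous F) (hK : Continuous K) :
    (matIntegral (μ.prod ν) fun z => F z.1 * K z.2) = matIntegral μ F * matIntegral ν K := by
  ext i j
  simp only [matIntegral, Matrix.mul_apply, Matrix.of_apply]
  rw [integral_finsetSum (f := fun k (z : X × Y) => F z.1 i k * K z.2 k j) _ fun k _ =>
    (integrable_of_continuous μ (hF.matrix_elem i k)).mul_prod
      (integrable_of_continuous ν (hK.matrix_elem k j))]
  exact Finset.sum_congr rfl fun k _ =>
    integral_prod_mul (fun x => F x i k) (fun y => K y k j)

namespace MatRep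

variable {N : ℕ} {R : MatRep (SU N)}

/-- The mean of a commutator in an irreducible representation. -/
lemma matIntegral_commutator (hR : R.IsIrreducible) :
    (matIntegral ((SU.haar N).prod (SU.haar N)) fun z => R.mat (z.1 * z.2 * z.1⁻¹ * z.2⁻¹)) =
      ((R.dim : ℂ) ^ 2)⁻¹ • 1 := by
  have hc : Continuous R.mat := R.continuous_mat
  have hci : Continuous fun U => R.mat U⁻¹ := hc.comp continuous_inv
  ext i j
  -- Entries of the first variable are grouped with those of its inverse, and likewise for the
  -- second, so that orthogonality applies to each group.
  have hexp : ∀ z : SU N × SU N, R.mat (z.1 * z.2 * z.1⁻¹ * z.2⁻¹) i j = ∑ m, ∑ l, ∑ k,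
      (R.mat z.1 i k * R.mat z.1⁻¹ l m) * (R.mat z.2 k l * R.mat z.2⁻¹ m j) := by
    intro z
    simp only [map_mul, Matrix.mul_apply, Finset.sum_mul]
    refine Finset.sum_congr rfl fun m _ => Finset.sum_congr rfl fun l _ =>
      Finset.sum_congr rfl fun k _ => ?_
    ring
  have hint : ∀ m l k, Integrable (fun z : SU N × SU N =>
      (R.mat z.1 i k * R.mat z.1⁻¹ l m) * (R.mat z.2 k l * R.mat z.2⁻¹ m j))
      ((SU.haar N).prod (SU.haar N)) := fun m l k =>
    (integrable_of_continuous (SU.haar N)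
      ((hc.matrix_elem i k).mul (hci.matrix_elem l m))).mul_prod
      (integrable_of_continuous (SU.haar N) ((hc.matrix_elem k l).mul (hci.matrix_elem m j)))
  simp only [matIntegral, Matrix.of_apply, hexp]
  rw [integral_finsetSum _ fun m _ => integrable_finsetSum _ fun l _ =>
    integrable_finsetSum _ fun k _ => hint m l k]
  -- The two orthogonality relations demand `i = m`, `k = l` and `k = j`, `l = m`. So all five
  -- indices coincide, and each relation contributes `1 / dim R`.
  have hterm : ∀ m l k, ∫ z : SU N × SU N,
      (R.mat z.1 i k * R.mat z.1⁻¹ l m) * (R.mat z.2 k l * R.mat z.2⁻¹ m j)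
        ∂((SU.haar N).prod (SU.haar N)) =
      if m = i then if l = i then if k = i then if i = j then ((R.dim : ℂ) ^ 2)⁻¹ else 0 else 0
        else 0 else 0 := by
    intro m l k
    rw [integral_prod_mul (fun U => R.mat U i k * R.mat U⁻¹ l m)
      (fun U => R.mat U k l * R.mat U⁻¹ m j), integral_mat_mul_mat_inv _ hR,
      integral_mat_mul_mat_inv _ hR]
    rw [sq, mul_inv]
    by_cases hm : m = i
    · by_cases hl : l = i
      · by_cases hk : k = i
        · by_cases hj : i = j <;> simp [hm, hl, hk, hj]
        · simp [hm, hl, hk]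
      · simp [hm, hl]
    · simp [hm, Ne.symm hm]
  have hsum : ∀ m, ∫ z : SU N × SU N, ∑ l, ∑ k,
      (R.mat z.1 i k * R.mat z.1⁻¹ l m) * (R.mat z.2 k l * R.mat z.2⁻¹ m j)
        ∂((SU.haar N).prod (SU.haar N)) = if m = i then if i = j then ((R.dim : ℂ) ^ 2)⁻¹ else 0
        else 0 := by
    intro m
    rw [integral_finsetSum _ fun l _ => integrable_finsetSum _ fun k _ => hint m l k]
    simp only [integral_finsetSum _ fun k _ => hint m _ k, hterm]
    by_cases hm : m = i <;> simp [hm]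
  simp only [hsum, Matrix.smul_apply, Matrix.one_apply, smul_eq_mul]
  simp

variable (R) in
lemma continuous_mat_handles (p : ℕ) : Continuous fun z : Fin p → SU N × SU N =>
    R.mat (List.ofFn fun i => (z i).1 * (z i).2 * (z i).1⁻¹ * (z i).2⁻¹).prod := by
  refine R.continuous_mat.comp ?_
  simp only [List.ofFn_eq_map]
  exact continuous_list_prod _ fun i _ => by fun_prop

/-- The mean of a product of `p` independent commutators. -/
lemma matIntegral_handles (hR : R.IsIrreducible) (p : ℕ) :
    (matIntegral (Measure.pi fun _ : Fin p => (SU.haar N).prod (SU.haar N)) fun z =>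
      R.mat (List.ofFn fun i => (z i).1 * (z i).2 * (z i).1⁻¹ * (z i).2⁻¹).prod) =
      ((R.dim : ℂ) ^ (2 * p))⁻¹ • 1 := by
  induction p with
  | zero =>
    ext i j
    simp [matIntegral]
  | succ p ih =>
    let F : SU N × SU N → Matrix (Fin R.dim) (Fin R.dim) ℂ := fun z =>
      R.mat (z.1 * z.2 * z.1⁻¹ * z.2⁻¹)
    let K : (Fin p → SU N × SU N) → Matrix (Fin R.dim) (Fin R.dim) ℂ := fun z =>
      R.mat (List.ofFn fun i => (z i).1 * (z i).2 * (z i).1⁻¹ * (z i).2⁻¹).prod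
    have hF : Continuous F := R.continuous_mat.comp (by fun_prop)
    have hK : Continuous K := R.continuous_mat_handles p
    -- Splits off the first handle, which is independent of the others.
    have hmp := measurePreserving_piFinSuccAbove
      (fun _ : Fin (p + 1) => (SU.haar N).prod (SU.haar N)) 0
    have h1 : (matIntegral (Measure.pi fun _ : Fin (p + 1) => (SU.haar N).prod (SU.haar N))
        fun z => R.mat (List.ofFn fun i => (z i).1 * (z i).2 * (z i).1⁻¹ * (z i).2⁻¹).prod) =
        matIntegral (((SU.haar N).prod (SU.haar N)).prod
          (Measure.pi fun _ : Fin p => (SU.haar N).prod (SU.haar N))) fun z => F z.1 * K z.2 := by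
      ext i j
      refine Eq.trans ?_ (hmp.integral_comp' fun z => (F z.1 * K z.2) i j)
      simp only [matIntegral, Matrix.of_apply]
      congr 1
      funext z
      rw [List.ofFn_succ, List.prod_cons, map_mul]
      rfl
    rw [h1, matIntegral_prod_mul _ _ hF hK, ih, matIntegral_commutator hR]
    rw [Matrix.smul_mul, Matrix.one_mul, smul_smul, ← mul_inv, ← pow_add]
    congr 3
    ring

/-- The mean of the character of the boundary holonomy. -/
lemma integral_char_boundaryHol (hR : R.IsIrreducible) (p : ℕ) (U : SU N) :
    ∫ z : HolData N p, R.char (boundaryHol U z) ∂(holMeasure N p) =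
      R.char U * ((R.dim : ℂ) ^ (2 * p))⁻¹ := by
  let F : SU N → Matrix (Fin R.dim) (Fin R.dim) ℂ := fun h => R.mat (h⁻¹ * U * h)
  let K : (Fin p → SU N × SU N) → Matrix (Fin R.dim) (Fin R.dim) ℂ := fun z =>
    R.mat (List.ofFn fun i => (z i).1 * (z i).2 * (z i).1⁻¹ * (z i).2⁻¹).prod
  have hF : Continuous F :=
    R.continuous_mat.comp ((continuous_inv.mul continuous_const).mul continuous_id)
  have hK : Continuous K := R.continuous_mat_handles p
  have h1 : ∀ z : HolData N p, R.char (boundaryHol U z) = (F z.1 * K z.2).trace := fun z => by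
    rw [char, boundaryHol, map_mul]
  simp only [h1]
  have hFK : Continuous fun z : HolData N p => F z.1 * K z.2 :=
    (hF.comp continuous_fst).matrix_mul (hK.comp continuous_snd)
  rw [holMeasure, ← trace_matIntegral _ hFK, matIntegral_prod_mul _ _ hF hK, matIntegral_handles hR,
    Matrix.mul_smul, Matrix.mul_one, Matrix.trace_smul, trace_matIntegral _ hF, smul_eq_mul,
    mul_comm]
  congr 1
  -- The handles have already averaged to a scalar, so the trace sees only a conjugate of `U`, for
  -- every `h`.
  have h2 : ∀ h, (F h).trace = R.char U := fun h => by
    simp only [F, map_mul]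
    rw [Matrix.trace_mul_comm, ← Matrix.mul_assoc, mat_mul_inv, Matrix.one_mul]
    rfl
  simp [h2]

/-- Reversing the loop only conjugates characters, so one computation of the holonomy integral
covers both directions. -/
lemma char_hol_eq (d : LoopDir) (R : MatRep (SU N)) :
    (∀ U, R.char (d.hol U) = R.char U) ∨ (∀ U, R.char (d.hol U) = (starRingEnd ℂ) (R.char U)) := by
  cases d
  · exact Or.inl fun U => rfl
  · exact Or.inr fun U => R.char_inv U

end MatRep

/-! ## Correlators -/

section Correlators

variable {N : ℕ} (g a : ℝ) (p : ℕ) (d : LoopDir)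

lemma corr_cls (U : SU N) (R : MatRep (SU N)) :
    corr g a p d (ConjClasses.mk U) (RepRing.cls R) = corrRep g a p d U R :=
  RepRing.lift_of _ _

lemma corr_cls_irreducible {R : MatRep (SU N)} (hR : R.IsIrreducible) (U : SU N) :
    corr g a p d (ConjClasses.mk U) (RepRing.cls R) = R.char (d.hol U) * weight g a p R := by
  have h1 : ∀ z : HolData N p, (R.mat (d.hol (boundaryHol U z)) * R.heat g a).trace =
      (Real.exp (-(g ^ 2 * a / 2) * R.C2) : ℂ) * R.char (d.hol (boundaryHol U z)) := fun z => by
    rw [MatRep.heat_eq_smul_one hR, Matrix.mul_smul, Matrix.mul_one, Matrix.trace_smul,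
      smul_eq_mul, MatRep.char]
  have h2 : ∫ z : HolData N p, R.char (d.hol (boundaryHol U z)) ∂(holMeasure N p) =
      R.char (d.hol U) * ((R.dim : ℂ) ^ (2 * p))⁻¹ := by
    rcases R.char_hol_eq d with h | h
    · simp only [h]
      exact MatRep.integral_char_boundaryHol hR p U
    · simp only [h]
      rw [integral_conj, MatRep.integral_char_boundaryHol hR p U]
      simp
  rw [corr_cls, corrRep]
  simp only [h1]
  rw [integral_const_mul, h2, weight]
  push_cast
  ring

lemma LoopDir.continuous_hol : Continuous (d.hol : SU N → SU N) := by
  cases d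
  · exact continuous_id
  · exact continuous_inv

/-- On irreducible classes the correlator is an explicit multiple of a character; these classes
generate the ring. Compactness then yields all integrability that gauging needs. -/
lemma continuous_corr (x : RepRing (SU N)) :
    Continuous fun U : SU N => corr g a p d (ConjClasses.mk U) x := by
  refine RepRing.induction_irreducible (p := fun x => Continuous fun U : SU N =>
    corr g a p d (ConjClasses.mk U) x) ?_ (fun x y hx hy => ?_) (fun x y hx hy => ?_)
    (fun R hR => ?_) x
  · simp only [map_zero]
    exact continuous_const
  · simp only [map_add]
    exact hx.add hy
  · simp only [map_sub]
    exact hx.sub hy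
  · simp only [corr_cls_irreducible g a p d hR]
    exact (R.continuous_char.comp (d.continuous_hol)).mul continuous_const

lemma integrable_gauged (κ : MatRep (SU N)) (x : RepRing (SU N)) :
    Integrable (fun U => κ.char U * corr g a p d (ConjClasses.mk U) x) (SU.haar N) :=
  integrable_of_continuous _ (κ.continuous_char.mul (continuous_corr g a p d x))

/-- Gauging as an additive map. -/
def gaugedHom (κ : MatRep (SU N)) : RepRing (SU N) →+ ℂ :=
  AddMonoidHom.mk' (gauged g a p d κ) fun x y => by
    simp only [gauged, map_add, mul_add]
    exact integral_add (integrable_gauged g a p d κ x) (integrable_gauged g a p d κ y)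

lemma gaugedHom_apply (κ : MatRep (SU N)) (x : RepRing (SU N)) :
    gaugedHom g a p d κ x = gauged g a p d κ x := rfl

end Correlators

/-! ### Selection rules, gauging and the projector. -/

section Selection

variable {N : ℕ}

/-- Converts a product of two characters at the same `U` into the form of the orthogonality
relations; hence the conjugate in the selection rule. -/
lemma MatRep.char_eq_conj_char_inv (R : MatRep (SU N)) (U : SU N) :
    R.char U = R.conj.char U⁻¹ := by
  rw [MatRep.char_conj, MatRep.char_inv, Complex.conj_conj]

lemma integral_char_mul_char_of_iso {R S : MatRep (SU N)} (hS : S.IsIrreducible)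
    (h : R.conj.Iso S) : ∫ U, R.char U * S.char U ∂(SU.haar N) = 1 := by
  rw [← MatRep.integral_char_mul_char_inv_self (SU.haar N) hS]
  simp only [R.char_eq_conj_char_inv, MatRep.char_iso h, mul_comm]

lemma integral_char_mul_char_of_not_iso {R S : MatRep (SU N)} (hR : R.IsIrreducible)
    (hS : S.IsIrreducible) (h : ¬ R.conj.Iso S) :
    ∫ U, R.char U * S.char U ∂(SU.haar N) = 0 := by
  rw [← MatRep.integral_char_mul_char_inv_of_not_iso (SU.haar N) hS hR.conj h]
  simp only [R.char_eq_conj_char_inv, mul_comm]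

variable (g a : ℝ) (p : ℕ) (d : LoopDir)

lemma pairing_cls {R S : MatRep (SU N)} (hR : R.IsIrreducible) (hS : S.IsIrreducible) :
    pairing g a p d (RepRing.cls R) (RepRing.cls S) =
      (weight g a p R * weight g a p S : ℂ) *
        ∫ U, R.char (d.hol U) * S.char (d.hol U) ∂(SU.haar N) := by
  simp only [pairing, corr_cls_irreducible g a p d hR, corr_cls_irreducible g a p d hS]
  rw [← integral_const_mul]
  congr 1
  funext U
  ring

/-- For `.along` both characters are conjugated. As the integrals are `0` or `1` for irreducible
representations, the pairing is the same for both directions. -/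
lemma integral_char_hol (R S : MatRep (SU N)) :
    ∫ U, R.char (d.hol U) * S.char (d.hol U) ∂(SU.haar N) =
      match d with
      | .opposite => ∫ U, R.char U * S.char U ∂(SU.haar N)
      | .along => (starRingEnd ℂ) (∫ U, R.char U * S.char U ∂(SU.haar N)) := by
  cases d
  · rfl
  · simp only [← integral_conj, map_mul, LoopDir.hol, MatRep.char_inv]

lemma pairing_cls_of_iso {R S : MatRep (SU N)} (hR : R.IsIrreducible) (hS : S.IsIrreducible)
    (h : R.conj.Iso S) :
    pairing g a p d (RepRing.cls R) (RepRing.cls S) = (weight g a p S : ℂ) ^ 2 := by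
  have hw : weight g a p R = weight g a p S := by rw [← weight_conj, weight_iso g a p h]
  rw [pairing_cls g a p d hR hS, integral_char_hol, integral_char_mul_char_of_iso hS h, hw]
  cases d <;> simp [sq]

lemma pairing_cls_of_not_iso {R S : MatRep (SU N)} (hR : R.IsIrreducible) (hS : S.IsIrreducible)
    (h : ¬ R.conj.Iso S) : pairing g a p d (RepRing.cls R) (RepRing.cls S) = 0 := by
  rw [pairing_cls g a p d hR hS, integral_char_hol, integral_char_mul_char_of_not_iso hR hS h]
  cases d <;> simp

lemma gauged_cls (κ : MatRep (SU N)) {R : MatRep (SU N)} (hR : R.IsIrreducible) :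
    gauged g a p d κ (RepRing.cls R) =
      (∫ U, κ.char U * R.char (d.hol U) ∂(SU.haar N)) * weight g a p R := by
  simp only [gauged, corr_cls_irreducible g a p d hR, ← mul_assoc]
  rw [integral_mul_const]

lemma gauged_cls_of_iso {κ R : MatRep (SU N)} (hR : R.IsIrreducible)
    (h : (d.selected κ).Iso R) : gauged g a p d κ (RepRing.cls R) = weight g a p R := by
  rw [gauged_cls g a p d κ hR]
  cases d
  · have h1 := integral_char_mul_char_of_iso hR h
    simp only [LoopDir.hol, h1, one_mul]
  · have h1 := MatRep.integral_char_mul_char_inv_self (SU.haar N) hR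
    have h2 : κ.char = R.char := MatRep.char_iso h
    simp only [LoopDir.hol, h2, h1, one_mul]

lemma gauged_cls_of_not_iso {κ R : MatRep (SU N)} (hκ : κ.IsIrreducible) (hR : R.IsIrreducible)
    (h : ¬ (d.selected κ).Iso R) : gauged g a p d κ (RepRing.cls R) = 0 := by
  rw [gauged_cls g a p d κ hR]
  cases d
  · have h1 := integral_char_mul_char_of_not_iso hκ hR h
    simp only [LoopDir.hol, h1, zero_mul]
  · have h1 := MatRep.integral_char_mul_char_inv_of_not_iso (SU.haar N) hκ hR
      fun h2 => h ((MatRep.setoid _).symm h2)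
    simp only [LoopDir.hol, h1, zero_mul]

/-- The correlator of `κ` is its character times its weight, so the two integrands agree up to this
nonzero constant; `x` need not be decomposed. -/
lemma gauged_opposite_eq_pairing {κ : MatRep (SU N)} (hκ : κ.IsIrreducible) (x : RepRing (SU N)) :
    gauged g a p .opposite κ x =
      (weight g a p κ : ℂ)⁻¹ * pairing g a p .opposite (RepRing.cls κ) x := by
  have hw : (weight g a p κ : ℂ) ≠ 0 := Complex.ofReal_ne_zero.mpr (weight_pos g a p hκ).ne'
  simp only [gauged, pairing, corr_cls_irreducible g a p _ hκ, LoopDir.hol]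
  rw [← integral_const_mul]
  congr 1
  funext U
  field_simp

/-- Here the correlator of `κ.conj` involves its character at `U⁻¹`, which is that of `κ` at `U`. -/
lemma gauged_along_eq_pairing {κ : MatRep (SU N)} (hκ : κ.IsIrreducible) (x : RepRing (SU N)) :
    gauged g a p .along κ x =
      (weight g a p κ : ℂ)⁻¹ * pairing g a p .along (RepRing.cls κ.conj) x := by
  have hw : (weight g a p κ : ℂ) ≠ 0 := Complex.ofReal_ne_zero.mpr (weight_pos g a p hκ).ne'
  simp only [gauged, pairing, corr_cls_irreducible g a p _ hκ.conj, LoopDir.hol, weight_conj,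
    ← κ.char_eq_conj_char_inv]
  rw [← integral_const_mul]
  congr 1
  funext U
  field_simp

/-- Gauging takes values in the integer multiples of the weight of `κ`. -/
lemma exists_gauged_eq_int_mul {κ : MatRep (SU N)} (hκ : κ.IsIrreducible) (x : RepRing (SU N)) :
    ∃ n : ℤ, gauged g a p d κ x = n * weight g a p κ := by
  refine RepRing.induction_irreducible (p := fun x => ∃ n : ℤ,
    gaugedHom g a p d κ x = n * weight g a p κ) ⟨0, by simp⟩ ?_ ?_ (fun R hR => ?_) x
  · rintro x y ⟨m, hm⟩ ⟨n, hn⟩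
    exact ⟨m + n, by rw [map_add, hm, hn]; push_cast; ring⟩
  · rintro x y ⟨m, hm⟩ ⟨n, hn⟩
    exact ⟨m - n, by rw [map_sub, hm, hn]; push_cast; ring⟩
  · rw [gaugedHom_apply]
    by_cases h : (d.selected κ).Iso R
    · refine ⟨1, ?_⟩
      rw [gauged_cls_of_iso g a p d hR h, ← weight_iso g a p h, weight_selected]
      simp
    · exact ⟨0, by rw [gauged_cls_of_not_iso g a p d hκ hR h]; simp⟩

/-- The multiplicity of the representation selected by gauging, as an additive map. -/
lemma exists_multiplicity {κ : MatRep (SU N)} (hκ : κ.IsIrreducible) :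
    ∃ n : RepRing (SU N) →+ ℤ, ∀ x, gauged g a p d κ x = n x * weight g a p κ := by
  have hw : (weight g a p κ : ℂ) ≠ 0 := Complex.ofReal_ne_zero.mpr (weight_pos g a p hκ).ne'
  choose n hn using exists_gauged_eq_int_mul g a p d hκ
  refine ⟨AddMonoidHom.mk' n fun x y => ?_, hn⟩
  -- Additivity of the gauging descends to the integers because the weight is nonzero.
  have h := map_add (gaugedHom g a p d κ) x y
  simp only [gaugedHom_apply, hn, ← add_mul] at h
  exact_mod_cast mul_right_cancel₀ hw h

lemma cls_iso {R S : MatRep (SU N)} (h : R.Iso S) : RepRing.cls R = RepRing.cls S :=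
  congrArg RepRing.of (Quotient.sound h)

lemma existsUnique_projector {κ : MatRep (SU N)} (hκ : κ.IsIrreducible) :
    ∃! P : RepRing (SU N) →+ RepRing (SU N),
      (∀ R : MatRep (SU N), R.IsIrreducible →
        ((d.selected κ).Iso R → P (RepRing.cls R) = RepRing.cls R) ∧
        (¬ (d.selected κ).Iso R → P (RepRing.cls R) = 0)) ∧
      (∀ x, P (P x) = P x) ∧
      ∀ x, ∃ n : ℤ, P x = n • RepRing.cls (d.selected κ) ∧
        gauged g a p d κ x = n * weight g a p κ := by
  have hw : (weight g a p κ : ℂ) ≠ 0 := Complex.ofReal_ne_zero.mpr (weight_pos g a p hκ).ne'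
  obtain ⟨n, hn⟩ := exists_multiplicity g a p d hκ
  have hiso : ∀ R : MatRep (SU N), R.IsIrreducible → (d.selected κ).Iso R →
      n (RepRing.cls R) = 1 := fun R hR h => by
    have h1 := hn (RepRing.cls R)
    rw [gauged_cls_of_iso g a p d hR h, ← weight_iso g a p h, weight_selected] at h1
    exact_mod_cast (mul_eq_right₀ hw).mp h1.symm
  have hniso : ∀ R : MatRep (SU N), R.IsIrreducible → ¬ (d.selected κ).Iso R →
      n (RepRing.cls R) = 0 := fun R hR h => by
    have h1 := hn (RepRing.cls R)
    rw [gauged_cls_of_not_iso g a p d hκ hR h] at h1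
    exact_mod_cast (mul_eq_zero.mp h1.symm).resolve_right hw
  have hsel : n (RepRing.cls (d.selected κ)) = 1 :=
    hiso _ (d.isIrreducible_selected hκ) ((MatRep.setoid _).refl _)
  -- The projector multiplies the selected class by the integer read off from gauging; it is
  -- idempotent since this integer is `1` on that class.
  let P : RepRing (SU N) →+ RepRing (SU N) :=
    AddMonoidHom.mk' (fun x => n x • RepRing.cls (d.selected κ)) fun x y => by
      rw [map_add, add_zsmul]
  have hP : ∀ x, P x = n x • RepRing.cls (d.selected κ) := fun _ => rfl
  refine ⟨P, ⟨fun R hR => ⟨fun h => ?_, fun h => ?_⟩, fun x => ?_, fun x => ⟨n x, rfl, hn x⟩⟩, ?_⟩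
  · rw [hP, hiso R hR h, one_zsmul, cls_iso h]
  · rw [hP, hniso R hR h, zero_zsmul]
  · rw [hP, hP, map_zsmul, hsel]
    simp
  · rintro Q ⟨hQ, -, -⟩
    refine AddMonoidHom.ext fun x => ?_
    refine RepRing.induction_irreducible (p := fun x => Q x = P x) (by simp)
      (fun x y hx hy => by rw [map_add, map_add, hx, hy])
      (fun x y hx hy => by rw [map_sub, map_sub, hx, hy]) (fun R hR => ?_) x
    by_cases h : (d.selected κ).Iso R
    · rw [(hQ R hR).1 h, hP, hiso R hR h, one_zsmul, cls_iso h]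
    · rw [(hQ R hR).2 h, hP, hniso R hR h, zero_zsmul]

end Selection

end YM

end

theorem proposition4p2 (N : ℕ) (g a : ℝ) (p : ℕ) (κ : MatRep (SU N)) (hκ : κ.IsIrreducible) :
    -- the Casimir operator acts on an irreducible representation by the scalar `C₂`
    (∀ R : MatRep (SU N), R.IsIrreducible → R.casimir = (R.C2 : ℂ) • 1) ∧
    -- the topological point operators act on Wilson loops through the character
    (∀ R : MatRep (SU N), R.IsIrreducible → ∀ U : SU N,
      corr g a p .opposite (ConjClasses.mk U) (RepRing.cls R) = R.char U * weight g a p R ∧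
      corr g a p .along (ConjClasses.mk U) (RepRing.cls R) = R.char U⁻¹ * weight g a p R) ∧
    -- the integral that defines the gauging converges
    (∀ (d : LoopDir) (x : RepRing (SU N)),
      Integrable (fun U => κ.char U * corr g a p d (ConjClasses.mk U) x) (SU.haar N)) ∧
    -- the pairing of irreducible representations
    (∀ (d : LoopDir) (R₁ R₂ : MatRep (SU N)), R₁.IsIrreducible → R₂.IsIrreducible →
      (R₁.conj.Iso R₂ →
        pairing g a p d (RepRing.cls R₁) (RepRing.cls R₂) = (weight g a p R₂ : ℂ) ^ 2) ∧
      (¬ R₁.conj.Iso R₂ → pairing g a p d (RepRing.cls R₁) (RepRing.cls R₂) = 0)) ∧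
    -- gauging selects a single irreducible representation
    (∀ (d : LoopDir) (R : MatRep (SU N)), R.IsIrreducible →
      ((d.selected κ).Iso R → gauged g a p d κ (RepRing.cls R) = weight g a p R) ∧
      (¬ (d.selected κ).Iso R → gauged g a p d κ (RepRing.cls R) = 0)) ∧
    -- gauging is the functional `⟨κ|` (or `⟨κ̄|`) on the Grothendieck ring
    (∀ x : RepRing (SU N),
      gauged g a p .opposite κ x =
        (weight g a p κ : ℂ)⁻¹ * pairing g a p .opposite (RepRing.cls κ) x ∧
      gauged g a p .along κ x =
        (weight g a p κ : ℂ)⁻¹ * pairing g a p .along (RepRing.cls κ.conj) x) ∧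
    -- it amounts to the projector of the Grothendieck ring onto the selected representation
    (∀ d : LoopDir, ∃! P : RepRing (SU N) →+ RepRing (SU N),
      (∀ R : MatRep (SU N), R.IsIrreducible →
        ((d.selected κ).Iso R → P (RepRing.cls R) = RepRing.cls R) ∧
        (¬ (d.selected κ).Iso R → P (RepRing.cls R) = 0)) ∧
      (∀ x, P (P x) = P x) ∧
      ∀ x, ∃ n : ℤ, P x = n • RepRing.cls (d.selected κ) ∧
        gauged g a p d κ x = n * weight g a p κ) := by
  exact ⟨fun R hR => MatRep.casimir_eq_smul_one hR,
    fun R hR U => ⟨corr_cls_irreducible g a p .opposite hR U,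
      corr_cls_irreducible g a p .along hR U⟩,
    fun d x => integrable_gauged g a p d κ x,
    fun d R₁ R₂ h₁ h₂ => ⟨pairing_cls_of_iso g a p d h₁ h₂, pairing_cls_of_not_iso g a p d h₁ h₂⟩,
    fun d R hR => ⟨gauged_cls_of_iso g a p d hR, gauged_cls_of_not_iso g a p d hκ hR⟩,
    fun x => ⟨gauged_opposite_eq_pairing g a p hκ x, gauged_along_eq_pairing g a p hκ x⟩,
    fun d => existsUnique_projector g a p d hκ⟩
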